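/- Let $n\ge 1$. For an integer $k\ge1$ and a distribution function $G$ on $[0,1]$ with $G(0)=0$, let $B(t\mid k,G)=\sum_{i=0}^{k}G(i/k)\binom{k}{i}t^i(1-t)^{k-i}$, $t\in[0,1]$, and $w_{j,k}=G(j/k)-G((j-1)/k)$ for $j=1,\dots,k$, so that $(w_{1,k},\dots,w_{k,k})$ lies in the unit simplex $S_k$. Let $\pi$ be a Bernstein prior: the law of $B(\cdot\mid k,G)$ for a random integer $k\ge1$ and a random distribution function $G$ on $[0,1]$ with $G(0)=0$, such that $\Pr(k=\kappa)>0$ for every $\kappa\ge1$ and such that, for every $\kappa\ge1$, the conditional law of $(w_{1,\kappa},\dots,w_{\kappa,\kappa})$ given $k=\kappa$ has a strictly positive density with respect to Lebesgue measure on $S_\kappa$ (for $\kappa=1$, unit mass at the single point of $S_1$). Under the prior, $F_1,\dots,F_n$ are independent with law $\pi$; put $$F=\Big(\frac1n\sum_{i=1}^nF_i^{-1}\Big)^{-1},\qquad T_i=F_i^{-1}\circ F,\quad i=1,\dots,n .$$ Given $F_1,\dots,F_n$, the observed points $x_{i,j}$ ($1\le i\le n$, $1\le j\le m_i$) are modelled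 as independent with $x_{i,j}\sim F_i$. The posterior of $(F_1,\dots,F_n)$ given the data is the one given by Bayes' formula, i.e. proportional to $\prod_{i=1}^n\prod_{j=1}^{m_i}F_i'(x_{i,j})$ times the prior; the posteriors of $F$ and of $T_i$ are the laws of $F$ and of $T_i$ under it. Let $\mathbb F_1,\dots,\mathbb F_n$ be absolutely continuous distribution functions on $[0,1]$ with continuous densities bounded away from zero, and put $\mathbb F=(\frac1n\sum_{i=1}^n\mathbb F_i^{-1})^{-1}$ and $\mathbb T_i=\mathbb F_i^{-1}\circ\mathbb F$. Suppose that the $x_{i,j}$ ($1\le i\le n$, $j\ge1$) are in truth independent with $x_{i,j}\sim\mathbb F_i$. Then, for this fixed $n$, the posterior of $F$ is weakly consistent at $\mathbb F$, and for each $i=1,\dots,n$ the posterior of $T_i$ is weakly consistent at $\mathbb T_i$, as $m_1,\dots,m_n\to\infty$ jointly: almost surely, the posterior probability that $F\in U$ tends to $1$ for every neighbourhood $U$ of $\mathbb F$, and the posterior probability that $T_i\in U$ tends to $1$ for every neighbourhood $U$ of $\mathbb T_i$, where neighbourhoods refer to the topology of weak convergence of distributions on $[0,1]$ (the $T_i$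 being regarded as distribution functions). -/

import Mathlib

open MeasureTheory ProbabilityTheory Filter Set
open scoped unitInterval ENNReal Topology

noncomputable section

namespace BernsteinWarp

/-- Continuous, strictly increasing distribution functions `F` on `[0,1]` with `F 0 = 0` and
`F 1 = 1`; equivalently, increasing homeomorphisms of `[0,1]` (warp functions). Every Bernstein
polynomial `B(· | k, G)` with `G 0 = 0` and every distribution function on `[0,1]` with a positive
density is one. For `F : DF`, `F.symm` is the quantile function `F⁻¹`. -/
abbrev DF : Type := I ≃o I

/-- The `σ`-algebra on `DF` generated by the evaluations `F ↦ F t`. -/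
instance : MeasurableSpace DF := MeasurableSpace.comap (fun F t => F t) MeasurableSpace.pi

/-- The probability measure on `[0,1]` whose distribution function is `F`: the image of the uniform
distribution under the quantile function (see `law_Iic`). -/
def law (F : DF) : ProbabilityMeasure I :=
  ⟨(volume : Measure I).map F.symm,
    Measure.isProbabilityMeasure_map F.symm.continuous.measurable.aemeasurable⟩

theorem law_Iic (F : DF) (t : I) : (law F : Measure I) (Iic t) = ENNReal.ofReal (F t : ℝ) := by
  have h : F.symm ⁻¹' Iic t = Iic (F t) := by
    ext u
    exact F.symm_apply_le
  simp only [law, ProbabilityMeasure.coe_mk]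
  rw [Measure.map_apply F.symm.continuous.measurable measurableSet_Iic, h]
  simp

/-- The neighbourhoods of `F` in the topology of weak convergence of distributions. -/
def weakNhds (F : DF) : Filter DF := comap law (𝓝 (law F))

/-- The density `F'` of `F`, as a function on `[0,1]` (one-sided derivatives at `0` and `1`). -/
def density (F : DF) (x : I) : ℝ :=
  derivWithin (IccExtend (zero_le_one (α := ℝ)) fun t => (F t : ℝ)) (Icc 0 1) x

/-- `F` is absolutely continuous, with a continuous density bounded away from zero on `[0,1]`. -/
def HasContinuousDensityBoundedBelow (F : DF) : Prop :=
  ∃ f : ℝ → ℝ, ContinuousOn f (Icc 0 1) ∧ (∃ c > 0, ∀ t ∈ Icc (0 : ℝ) 1, c ≤ f t) ∧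
    ∀ t : I, (F t : ℝ) = ∫ s in (0 : ℝ)..t, f s

/-! ### The Bernstein prior -/

/-- Distribution functions `G` on `[0,1]`, not necessarily continuous, with `G 0 = 0`. -/
def DistFun : Type :=
  {G : I → ℝ // Monotone G ∧ (∀ t, ContinuousWithinAt G (Ici t) t) ∧ G 0 = 0 ∧ G 1 = 1}

/-- The `σ`-algebra on `DistFun` generated by the evaluations. -/
instance : MeasurableSpace DistFun := inferInstanceAs (MeasurableSpace (Subtype _))

/-- `B(t | k, G) = ∑_{i=0}^k G(i/k) (k choose i) tⁱ (1-t)^(k-i)`. -/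
def bernsteinFun (k : ℕ+) (G : DistFun) (t : ℝ) : ℝ :=
  ∑ i : Fin ((k : ℕ) + 1),
    G.1 (bernstein.z i) * (((k : ℕ).choose i : ℝ) * t ^ (i : ℕ) * (1 - t) ^ ((k : ℕ) - i))

/-- The weights `w_{j,k} = G(j/k) - G((j-1)/k)`, `j = 1, …, k` (indexed by `j - 1 : Fin k`). -/
def weights (k : ℕ+) (G : DistFun) : Fin k → ℝ :=
  fun j => G.1 (bernstein.z j.succ) - G.1 (bernstein.z j.castSucc)

theorem sum_weights (k : ℕ+) (G : DistFun) : ∑ j, weights k G j = 1 := by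
  have h := Fin.sum_univ_succ (fun i : Fin ((k : ℕ) + 1) => G.1 (bernstein.z i))
  have h' := Fin.sum_univ_castSucc (fun i : Fin ((k : ℕ) + 1) => G.1 (bernstein.z i))
  have h0 : G.1 (bernstein.z (0 : Fin ((k : ℕ) + 1))) = 0 := by
    rw [bernstein.z_zero]; exact G.2.2.2.1
  have h1 : G.1 (bernstein.z (Fin.last (k : ℕ))) = 1 := by
    rw [bernstein.z_last k.ne_zero]; exact G.2.2.2.2
  simp only [weights, Finset.sum_sub_distrib]
  linarith

theorem weights_nonneg (k : ℕ+) (G : DistFun) (j : Fin k) : 0 ≤ weights k G j := by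
  refine sub_nonneg.2 (G.2.1 ?_)
  simp only [bernstein.z, Subtype.mk_le_mk, Fin.val_succ, Fin.val_castSucc]
  gcongr
  linarith

theorem hasDerivAt_bernsteinFun (k : ℕ+) (G : DistFun) (t : ℝ) :
    HasDerivAt (bernsteinFun k G) (∑ j : Fin k, weights k G j * ((k : ℕ) *
      ((((k : ℕ) - 1).choose j : ℝ) * t ^ (j : ℕ) * (1 - t) ^ ((k : ℕ) - 1 - j)))) t := by
  have key : ∀ (m : ℕ) (a : Fin (m + 1) → ℝ), Polynomial.derivative
      (∑ i, Polynomial.C (a i) * bernsteinPolynomial ℝ m i)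
      = ∑ j : Fin m, Polynomial.C (a j.succ - a j.castSucc) *
          ((m : Polynomial ℝ) * bernsteinPolynomial ℝ (m - 1) j) := by
    intro m a
    rcases m with _ | m
    · simp [bernsteinPolynomial]
    rw [Fin.sum_univ_succ]
    simp only [map_add, map_sum, Polynomial.derivative_C_mul, Fin.val_succ, Fin.val_zero,
      bernsteinPolynomial.derivative_succ, bernsteinPolynomial.derivative_zero, map_sub]
    have h2 := Fin.sum_univ_succ (fun i : Fin (m + 2) =>
      Polynomial.C (a i) * bernsteinPolynomial ℝ m i)
    rw [Fin.sum_univ_castSucc] at h2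
    simp only [Fin.val_castSucc, Fin.val_last, Fin.val_zero, Fin.val_succ,
      bernsteinPolynomial.eq_zero_of_lt ℝ (Nat.lt_succ_self m), mul_zero, add_zero] at h2
    simp only [sub_mul, Finset.sum_sub_distrib, mul_sub, Nat.add_sub_cancel, mul_left_comm _
      ((m + 1 : ℕ) : Polynomial ℝ), ← Finset.mul_sum, neg_mul, mul_neg]
    rw [h2]
    ring
  have h := (∑ i, Polynomial.C (G.1 (bernstein.z i)) *
    bernsteinPolynomial ℝ (k : ℕ) (i : Fin ((k : ℕ) + 1))).hasDerivAt t
  rw [key] at h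
  have hB : bernsteinFun k G = fun t : ℝ => ∑ i : Fin ((k : ℕ) + 1), G.1 (bernstein.z i) *
    (((k : ℕ).choose i : ℝ) * t ^ (i : ℕ) * (1 - t) ^ ((k : ℕ) - i)) := rfl
  rw [hB]
  simpa [Polynomial.eval_finsetSum, bernsteinPolynomial, weights,
    Polynomial.eval_mul, Function.comp_def] using h

theorem bernsteinFun_strictMonoOn (k : ℕ+) (G : DistFun) :
    StrictMonoOn (bernsteinFun k G) (Icc 0 1) := by
  refine strictMonoOn_of_deriv_pos (convex_Icc 0 1)
    (fun t _ => (hasDerivAt_bernsteinFun k G t).continuousAt.continuousWithinAt) ?_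
  intro t ht
  rw [interior_Icc] at ht
  rw [(hasDerivAt_bernsteinFun k G t).deriv]
  have h0 := ht.1
  have h1 : 0 < 1 - t := sub_pos.2 ht.2
  have hb : ∀ j : Fin k, 0 < ((k : ℕ) : ℝ) *
      ((((k : ℕ) - 1).choose j : ℝ) * t ^ (j : ℕ) * (1 - t) ^ ((k : ℕ) - 1 - j)) := by
    intro j
    have : 0 < ((k : ℕ) - 1).choose j := Nat.choose_pos (by omega)
    have := k.pos
    positivity
  refine Finset.sum_pos' (fun j _ => mul_nonneg (weights_nonneg k G j) (hb j).le) ?_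
  by_contra hc
  push Not at hc
  have hw : ∀ j, weights k G j = 0 := by
    intro j
    refine le_antisymm ?_ (weights_nonneg k G j)
    by_contra hj
    push Not at hj
    exact absurd (hc j (Finset.mem_univ j)) (not_le.2 (mul_pos hj (hb j)))
  have := sum_weights k G
  simp [hw] at this

theorem bernsteinFun_zero (k : ℕ+) (G : DistFun) : bernsteinFun k G 0 = 0 := by
  rw [bernsteinFun, Fin.sum_univ_succ]
  simp [G.2.2.2.1]

theorem bernsteinFun_one (k : ℕ+) (G : DistFun) : bernsteinFun k G 1 = 1 := by
  rw [bernsteinFun, Fin.sum_univ_castSucc]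
  rw [Finset.sum_eq_zero]
  · simp [G.2.2.2.2]
  · intro i _
    have : (k : ℕ) - i ≠ 0 := by omega
    simp [this]

/-- A strictly increasing continuous self-map of `[0,1]` fixing `0` and `1`, as an element of
`DF`. -/
def mkDF (F : I → I) (hm : StrictMono F) (hc : Continuous F) (h0 : F 0 = 0) (h1 : F 1 = 1) : DF :=
  hm.orderIsoOfSurjective F fun u =>
    mem_range_of_exists_le_of_exists_ge hc ⟨0, h0.le.trans u.2.1⟩ ⟨1, le_of_le_of_eq u.2.2 h1.symm⟩

/-- The Bernstein polynomial `B(· | k, G)` as a distribution function. -/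
def bernsteinDF (k : ℕ+) (G : DistFun) : DF :=
  mkDF (fun t => ⟨bernsteinFun k G t, by
      have hm := (bernsteinFun_strictMonoOn k G).monotoneOn
      constructor
      · have := hm (left_mem_Icc.2 zero_le_one) t.2 t.2.1
        rwa [bernsteinFun_zero] at this
      · have := hm t.2 (right_mem_Icc.2 zero_le_one) t.2.2
        rwa [bernsteinFun_one] at this⟩)
    (fun s t hst => bernsteinFun_strictMonoOn k G s.2 t.2 hst)
    (by
      refine Continuous.subtype_mk ?_ _
      exact (continuous_iff_continuousAt.2
        fun t => (hasDerivAt_bernsteinFun k G t).continuousAt).comp continuous_subtype_val)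
    (Subtype.ext (bernsteinFun_zero k G)) (Subtype.ext (bernsteinFun_one k G))

theorem bernsteinDF_apply (k : ℕ+) (G : DistFun) (t : I) :
    (bernsteinDF k G t : ℝ) = bernsteinFun k G t := rfl

/-- The Bernstein prior `π(k, G)`: the law of `B(· | k, G)`, for a random degree `k` and a random
distribution function `G`. -/
def bernsteinPrior {Ω₀ : Type*} [MeasurableSpace Ω₀] (ρ : Measure Ω₀) (k : Ω₀ → ℕ+)
    (G : Ω₀ → DistFun) : Measure DF :=
  ρ.map fun ω => bernsteinDF (k ω) (G ω)

/-- Lebesgue measure on the simplex `S_k`, in the coordinates `w_1, …, w_{k-1}` (the last one being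
`1 - w_1 - ⋯ - w_{k-1}`); the unit mass at the only point of `S_k` for `k = 1`. -/
def simplexVolume : (k : ℕ) → Measure (Fin k → ℝ)
  | 0 => 0
  | k + 1 =>
    ((volume : Measure (Fin k → ℝ)).map
      fun v => (Fin.snoc v (1 - ∑ i, v i) : Fin (k + 1) → ℝ)).restrict (stdSimplex ℝ (Fin (k + 1)))

/-- Every degree has positive probability, and given `k` the weights `(w_{1,k}, …, w_{k,k})` have a
strictly positive conditional density on the simplex `S_k`. -/
def HasPositiveWeightDensities {Ω₀ : Type*} [MeasurableSpace Ω₀] (ρ : Measure Ω₀) (k : Ω₀ → ℕ+)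
    (G : Ω₀ → DistFun) : Prop :=
  ∀ κ : ℕ+, 0 < ρ (k ⁻¹' {κ}) ∧
    ∃ l : (Fin κ → ℝ) → ℝ, Measurable l ∧ (∀ w ∈ stdSimplex ℝ (Fin κ), 0 < l w) ∧
      (ρ[|k ⁻¹' {κ}]).map (fun ω => weights κ (G ω)) =
        (simplexVolume κ).withDensity fun w => ENNReal.ofReal (l w)

/-! ### Fréchet–Wasserstein mean and warp functions -/

/-- The average `n⁻¹ ∑ F_i⁻¹` of the quantile functions. -/
def meanQuantile {n : ℕ} [NeZero n] (F : Fin n → DF) : DF :=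
  mkDF (fun u => ⟨(1 / (n : ℝ)) * ∑ i, ((F i).symm u : ℝ), by
      have hn : (0 : ℝ) < n := Nat.cast_pos.2 (NeZero.pos n)
      have hs : ∑ i, ((F i).symm u : ℝ) ≤ n :=
        (Finset.sum_le_sum fun i _ => ((F i).symm u).2.2).trans (by simp)
      constructor
      · exact mul_nonneg (by positivity) (Finset.sum_nonneg fun i _ => ((F i).symm u).2.1)
      · rw [one_div, inv_mul_le_iff₀ hn, mul_one]
        exact hs⟩)
    (by
      intro s t hst
      have hn : (0 : ℝ) < n := Nat.cast_pos.2 (NeZero.pos n)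
      refine Subtype.mk_lt_mk.2 (mul_lt_mul_of_pos_left ?_ (by positivity))
      exact Finset.sum_lt_sum_of_nonempty Finset.univ_nonempty
        fun i _ => Subtype.coe_lt_coe.2 ((F i).symm.strictMono hst))
    (by
      refine Continuous.subtype_mk (continuous_const.mul (continuous_finsetSum _ fun i _ => ?_)) _
      exact continuous_subtype_val.comp (F i).symm.continuous)
    (by
      have h : ∀ i, (F i).symm 0 = 0 := fun i => (F i).symm.map_bot
      exact Subtype.ext (by simp [h]))
    (by
      have hn : (n : ℝ) ≠ 0 := NeZero.ne _
      have h : ∀ i, (F i).symm 1 = 1 := fun i => (F i).symm.map_top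
      exact Subtype.ext (by simp [h, hn]))

/-- The Fréchet–Wasserstein mean `F = (n⁻¹ ∑ F_i⁻¹)⁻¹`. -/
def frechetMean {n : ℕ} [NeZero n] (F : Fin n → DF) : DF := (meanQuantile F).symm

/-- The warp functions (optimal transport maps) `T_i = F_i⁻¹ ∘ F`. -/
def warp {n : ℕ} [NeZero n] (i : Fin n) (F : Fin n → DF) : DF := (frechetMean F).trans (F i).symm

theorem frechetMean_symm_apply {n : ℕ} [NeZero n] (F : Fin n → DF) (u : I) :
    ((frechetMean F).symm u : ℝ) = (1 / (n : ℝ)) * ∑ i, ((F i).symm u : ℝ) := rfl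

theorem warp_apply {n : ℕ} [NeZero n] (i : Fin n) (F : Fin n → DF) (t : I) :
    warp i F t = (F i).symm (frechetMean F t) := rfl

/-! ### Posterior -/

/-- The likelihood `∏_i ∏_{j < m_i} F_i'(x_{i,j})`. -/
def likelihood {n : ℕ} (m : Fin n → ℕ) (x : Fin n → ℕ → I) (F : Fin n → DF) : ℝ≥0∞ :=
  ∏ i, ∏ j ∈ Finset.range (m i), ENNReal.ofReal (density (F i) (x i j))

/-- The posterior of `(F_1, …, F_n)` by Bayes' formula, for the prior `Q` and the observations
`x_{i,j}`, `j < m_i`, which given `(F_1, …, F_n)` are independent with `x_{i,j} ∼ F_i`. -/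
def jointPosterior {n : ℕ} (Q : Measure (Fin n → DF)) (m : Fin n → ℕ) (x : Fin n → ℕ → I) :
    Measure (Fin n → DF) :=
  (∫⁻ F, likelihood m x F ∂Q)⁻¹ • Q.withDensity (likelihood m x)

/-- Weak consistency at `F₀` of random measures `post m ω` as `m_1, …, m_n → ∞`: almost surely, the
mass of every weak neighbourhood of `F₀` tends to one. -/
def WeaklyConsistent {n : ℕ} {Ω : Type*} [MeasurableSpace Ω] (P : Measure Ω)
    (post : (Fin n → ℕ) → Ω → Measure DF) (F₀ : DF) : Prop :=
  ∀ᵐ ω ∂P, ∀ U ∈ weakNhds F₀, Tendsto (fun m => post m ω U) atTop (𝓝 1)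

end BernsteinWarp

end

open BernsteinWarp

noncomputable section

namespace BernsteinWarp

/-! The prior and the likelihood are both products over `i`, so the joint posterior of a box is a
product of one-sample posteriors (`jointPosterior_univ_pi`). This reduces the claim to consistency
for one sample, plus continuity of `frechetMean` and `warp i`.

For one sample the argument is Schwartz's. The evidence is divided by the true likelihood. The
denominator decays slower than any exponential: Bernstein approximation and the positive weight
densities give positive prior mass to densities that are everywhere at least `exp (-ε)` times the
true one (`exists_measure_pos_density_ge`). This bound is pointwise, so it holds for every data
sequence and needs no Kullback–Leibler argument. The numerator, over distribution functions whose
value at `t` lies on the wrong side of a level `q`, decays exponentially: tilting by `exp (ψ (x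
j))`, with `ψ` a multiple of the indicator of `Iic t`, makes the expectation geometric; summability
controls it almost surely, and the strong law removes the tilt
(`exists_ae_eventually_likelihoodRatio_le`).

Letting `t` and `q` run through a countable dense set gives one null set outside which the posterior
concentrates in the topology of pointwise convergence. For increasing bijections of `[0,1]` this
convergence passes to inverses, averages and compositions, hence to weak convergence of the laws of
`frechetMean` and `warp i`. -/

/-! ### Convergence of increasing bijections and of their inverses -/

theorem tendsto_symm_of_dense {α : Type*} {L : Filter α} {H : α → DF} {H₀ : DF} {s : Set I}
    (hs : Dense s) (h : ∀ d ∈ s, Tendsto (fun a => H a d) L (𝓝 (H₀ d))) (u : I) :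
    Tendsto (fun a => (H a).symm u) L (𝓝 (H₀.symm u)) := by
  refine tendsto_order.2 ⟨fun b hb => ?_, fun b hb => ?_⟩
  · obtain ⟨d, hd, hbd, hdu⟩ := hs.exists_between hb
    have hlt : H₀ d < u := by simpa using H₀.strictMono hdu
    filter_upwards [(h d hd).eventually_lt_const hlt] with a ha
    exact hbd.trans ((H a).lt_symm_apply.2 ha)
  · obtain ⟨d, hd, hdu, hbd⟩ := hs.exists_between hb
    have hlt : u < H₀ d := by simpa using H₀.strictMono hdu
    filter_upwards [(h d hd).eventually_const_lt hlt] with a ha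
    exact ((H a).symm_apply_lt.2 ha).trans hbd

/-- Inverting twice upgrades convergence on a dense set to convergence everywhere. -/
theorem tendsto_apply_of_dense {α : Type*} {L : Filter α} {H : α → DF} {H₀ : DF} {s : Set I}
    (hs : Dense s) (h : ∀ d ∈ s, Tendsto (fun a => H a d) L (𝓝 (H₀ d))) (u : I) :
    Tendsto (fun a => H a u) L (𝓝 (H₀ u)) :=
  tendsto_symm_of_dense (H := fun a => (H a).symm) (H₀ := H₀.symm) dense_univ
    (fun d _ => tendsto_symm_of_dense hs h d) u

/-- Monotone functions converging pointwise to a continuous limit converge continuously. -/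
theorem tendsto_apply_of_tendsto {α : Type*} {L : Filter α} {H : α → DF} {H₀ : DF}
    (h : ∀ u, Tendsto (fun a => H a u) L (𝓝 (H₀ u))) {v : α → I} {v₀ : I}
    (hv : Tendsto v L (𝓝 v₀)) : Tendsto (fun a => H a (v a)) L (𝓝 (H₀ v₀)) := by
  refine tendsto_order.2 ⟨fun b hb => ?_, fun b hb => ?_⟩
  · have hb' : H₀.symm b < v₀ := H₀.symm_apply_lt.2 hb
    obtain ⟨d, hbd, hdv⟩ := exists_between hb'
    filter_upwards [(h d).eventually_const_lt (H₀.symm_apply_lt.1 hbd),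
      hv.eventually_const_lt hdv] with a ha hva
    exact ha.trans ((H a).strictMono hva)
  · have hb' : v₀ < H₀.symm b := H₀.lt_symm_apply.2 hb
    obtain ⟨d, hvd, hdb⟩ := exists_between hb'
    filter_upwards [(h d).eventually_lt_const (H₀.lt_symm_apply.1 hdb),
      hv.eventually_lt_const hvd] with a ha hva
    exact ((H a).strictMono hva).trans ha

/-- Integrals against `law F` are integrals of `f ∘ F.symm` over the uniform distribution, so
dominated convergence applies; this is where the filter has to be countably generated. -/
theorem tendsto_law {α : Type*} {L : Filter α} [L.IsCountablyGenerated] {H : α → DF} {H₀ : DF}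
    (h : ∀ u, Tendsto (fun a => (H a).symm u) L (𝓝 (H₀.symm u))) :
    Tendsto (fun a => law (H a)) L (𝓝 (law H₀)) := by
  rw [ProbabilityMeasure.tendsto_iff_forall_integral_tendsto]
  intro f
  have key : ∀ F : DF, ∫ t, f t ∂(law F : Measure I) = ∫ u, f (F.symm u) := fun F =>
    integral_map F.symm.continuous.measurable.aemeasurable
      f.continuous.measurable.aestronglyMeasurable
  simp only [key]
  refine tendsto_integral_filter_of_dominated_convergence (fun _ => ‖f‖)
    (Eventually.of_forall fun a =>
      (f.continuous.comp (H a).symm.continuous).measurable.aestronglyMeasurable)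
    (Eventually.of_forall fun a => ae_of_all _ fun u => f.norm_coe_le_norm _)
    (integrable_const _) (ae_of_all _ fun u => (f.continuous.tendsto _).comp (h u))

theorem tendsto_meanQuantile {n : ℕ} [NeZero n] {α : Type*} {L : Filter α} {H : α → Fin n → DF}
    {H₀ : Fin n → DF} (h : ∀ i u, Tendsto (fun a => (H a i).symm u) L (𝓝 ((H₀ i).symm u))) (u : I) :
    Tendsto (fun a => meanQuantile (H a) u) L (𝓝 (meanQuantile H₀ u)) := by
  rw [tendsto_subtype_rng]
  exact tendsto_const_nhds.mul
    (tendsto_finsetSum _ fun i _ => (continuous_subtype_val.tendsto _).comp (h i u))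

/-! ### Continuity of the Fréchet mean and of the warp functions -/

/-- The topology of pointwise convergence on a countable dense set, at `F₀`. -/
def pointwiseNhds {n : ℕ} (F₀ : Fin n → DF) : Filter (Fin n → DF) :=
  comap (fun F (p : Fin n × ℕ) => F p.1 (TopologicalSpace.denseSeq I p.2))
    (𝓝 fun p => F₀ p.1 (TopologicalSpace.denseSeq I p.2))

instance {n : ℕ} (F₀ : Fin n → DF) : (pointwiseNhds F₀).IsCountablyGenerated := by
  unfold pointwiseNhds; infer_instance

theorem tendsto_apply_pointwiseNhds {n : ℕ} (F₀ : Fin n → DF) (i : Fin n) (u : I) :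
    Tendsto (fun F => F i u) (pointwiseNhds F₀) (𝓝 (F₀ i u)) := by
  refine tendsto_apply_of_dense (H := fun F : Fin n → DF => F i)
    (TopologicalSpace.denseRange_denseSeq I) ?_ u
  rintro _ ⟨j, rfl⟩
  exact ((continuous_apply (i, j)).tendsto (fun p : Fin n × ℕ =>
    F₀ p.1 (TopologicalSpace.denseSeq I p.2))).comp tendsto_comap

theorem tendsto_symm_pointwiseNhds {n : ℕ} (F₀ : Fin n → DF) (i : Fin n) (u : I) :
    Tendsto (fun F => (F i).symm u) (pointwiseNhds F₀) (𝓝 ((F₀ i).symm u)) :=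
  tendsto_symm_of_dense (H := fun F : Fin n → DF => F i) dense_univ
    (fun d _ => tendsto_apply_pointwiseNhds F₀ i d) u

theorem tendsto_frechetMean {n : ℕ} [NeZero n] (F₀ : Fin n → DF) :
    Tendsto frechetMean (pointwiseNhds F₀) (weakNhds (frechetMean F₀)) :=
  tendsto_comap_iff.2 (tendsto_law (tendsto_meanQuantile (tendsto_symm_pointwiseNhds F₀)))

/-- The inverse of `warp i F` is `meanQuantile F ∘ F i`. Both factors vary with `F`, which is why
continuous convergence is needed rather than pointwise convergence. -/
theorem tendsto_warp {n : ℕ} [NeZero n] (i : Fin n) (F₀ : Fin n → DF) :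
    Tendsto (warp i) (pointwiseNhds F₀) (weakNhds (warp i F₀)) :=
  tendsto_comap_iff.2 (tendsto_law fun u =>
    tendsto_apply_of_tendsto (H := meanQuantile)
      (tendsto_meanQuantile (tendsto_symm_pointwiseNhds F₀)) (tendsto_apply_pointwiseNhds F₀ i u))

/-! ### Measurability of inverses, means and warps -/

theorem measurable_apply (t : I) : Measurable fun F : DF => F t :=
  (measurable_pi_apply t).comp (comap_measurable _)

theorem measurable_of_apply {α : Type*} [MeasurableSpace α] {H : α → DF}
    (h : ∀ t, Measurable fun a => H a t) : Measurable H :=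
  measurable_comap_iff.2 (measurable_pi_iff.2 h)

theorem measurable_symm {α : Type*} [MeasurableSpace α] {H : α → DF} (h : Measurable H) :
    Measurable fun a => (H a).symm := by
  refine measurable_of_apply fun t => measurable_of_Iic fun s => ?_
  have : (fun a => (H a).symm t) ⁻¹' Iic s = (fun a => H a s) ⁻¹' Ici t := by
    ext a; exact (H a).symm_apply_le
  rw [this]
  exact ((measurable_apply s).comp h) measurableSet_Ici

theorem measurable_meanQuantile {n : ℕ} [NeZero n] :
    Measurable (meanQuantile : (Fin n → DF) → DF) := by
  refine measurable_of_apply fun t => Measurable.subtype_mk ?_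
  refine measurable_const.mul (Finset.measurable_sum _ fun i _ => ?_)
  exact measurable_subtype_coe.comp
    ((measurable_apply t).comp (measurable_symm (measurable_pi_apply i)))

theorem measurable_frechetMean {n : ℕ} [NeZero n] :
    Measurable (frechetMean : (Fin n → DF) → DF) := measurable_symm measurable_meanQuantile

/-- The Galois connection turns a random function evaluated at a random point into a comparison of
two evaluations at fixed points. -/
theorem measurable_warp {n : ℕ} [NeZero n] (i : Fin n) : Measurable (warp i) := by
  refine measurable_of_apply fun t => measurable_of_Iic fun s => ?_
  have : (fun F : Fin n → DF => warp i F t) ⁻¹' Iic s = {F | frechetMean F t ≤ F i s} := by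
    ext F; exact (F i).symm_apply_le
  rw [this]
  exact measurableSet_le ((measurable_apply t).comp measurable_frechetMean)
    ((measurable_apply s).comp (measurable_pi_apply i))

/-! ### Densities of Bernstein polynomials -/

/-- The derivative of `B(· | k, G)`. -/
def bernsteinDensity (k : ℕ+) (G : DistFun) (t : ℝ) : ℝ :=
  ∑ j : Fin k, weights k G j * ((k : ℕ) *
    ((((k : ℕ) - 1).choose j : ℝ) * t ^ (j : ℕ) * (1 - t) ^ ((k : ℕ) - 1 - j)))

theorem density_eq_of_hasDerivAt {F : DF} {f : ℝ → ℝ} {f' : ℝ} {x : I} (hF : ∀ t : I, (F t : ℝ) = f t)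
    (hf : HasDerivAt f f' x) : density F x = f' := by
  have h : HasDerivWithinAt (IccExtend (zero_le_one (α := ℝ)) fun t => (F t : ℝ)) f' (Icc 0 1) x := by
    refine hf.hasDerivWithinAt.congr (fun y hy => ?_) ?_
    · rw [IccExtend_of_mem _ _ hy, hF]
    · rw [IccExtend_of_mem _ _ x.2, hF]
  exact h.derivWithin (uniqueDiffOn_Icc_zero_one x x.2)

theorem density_bernsteinDF (k : ℕ+) (G : DistFun) (x : I) :
    density (bernsteinDF k G) x = bernsteinDensity k G x :=
  density_eq_of_hasDerivAt (bernsteinDF_apply k G) (hasDerivAt_bernsteinFun k G x)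

theorem continuous_bernsteinDensity (k : ℕ+) (G : DistFun) :
    Continuous (bernsteinDensity k G) := by
  unfold bernsteinDensity; fun_prop

theorem bernsteinDensity_nonneg (k : ℕ+) (G : DistFun) {t : ℝ} (ht : t ∈ Icc (0 : ℝ) 1) :
    0 ≤ bernsteinDensity k G t := by
  have h0 := ht.1
  have h1 : 0 ≤ 1 - t := sub_nonneg.2 ht.2
  exact Finset.sum_nonneg fun j _ => mul_nonneg (weights_nonneg k G j) (by positivity)

theorem law_eq_withDensity {F : DF} {f : ℝ → ℝ} (hf : ContinuousOn f (Icc 0 1))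
    (h0 : ∀ t ∈ Icc (0 : ℝ) 1, 0 ≤ f t) (h : ∀ t : I, (F t : ℝ) = ∫ s in (0 : ℝ)..t, f s) :
    (law F : Measure I) = (volume : Measure I).withDensity fun x => ENNReal.ofReal (f x) := by
  refine Measure.ext_of_Iic _ _ fun t => ?_
  have hsub : Ioc (0 : ℝ) t ⊆ Icc 0 1 := fun s hs => ⟨hs.1.le, hs.2.trans t.2.2⟩
  have hint : IntegrableOn f (Ioc 0 (t : ℝ)) := (hf.integrableOn_Icc).mono_set hsub
  rw [law_Iic, h, withDensity_apply _ measurableSet_Iic, intervalIntegral.integral_of_le t.2.1,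
    ofReal_integral_eq_lintegral_ofReal hint
      ((ae_restrict_iff' measurableSet_Ioc).2 (ae_of_all _ fun s hs => h0 s (hsub hs))),
    ← unitInterval.measurableEmbedding_coe.lintegral_map (μ := volume.restrict (Iic t))
      (f := fun s => ENNReal.ofReal (f s))]
  congr 1
  rw [unitInterval.volume_def]
  have : Iic t = Subtype.val ⁻¹' (Icc (0 : ℝ) t) := by
    ext s; simp [s.2.1]
  rw [this, ← unitInterval.measurableEmbedding_coe.restrict_map,
    unitInterval.measurableEmbedding_coe.map_comap, Subtype.range_coe,
    Measure.restrict_restrict measurableSet_Icc,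
    inter_eq_self_of_subset_left (Icc_subset_Icc_right t.2.2)]
  exact Measure.restrict_congr_set Ioc_ae_eq_Icc

theorem law_bernsteinDF (k : ℕ+) (G : DistFun) : (law (bernsteinDF k G) : Measure I) =
    (volume : Measure I).withDensity fun x => ENNReal.ofReal (bernsteinDensity k G x) := by
  refine law_eq_withDensity (continuous_bernsteinDensity k G).continuousOn
    (fun t ht => bernsteinDensity_nonneg k G ht) fun t => ?_
  rw [intervalIntegral.integral_eq_sub_of_hasDerivAt (f' := bernsteinDensity k G)
    (fun s _ => hasDerivAt_bernsteinFun k G s)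
    ((continuous_bernsteinDensity k G).intervalIntegrable _ _), bernsteinFun_zero, sub_zero,
    bernsteinDF_apply]

/-! ### Almost everywhere measurability of the density functional -/

/-- The elements of `DF` that coincide, on a dense sequence, with their Lagrange interpolation of
degree `k` at equally spaced nodes. -/
def interpolated (k : ℕ) : Set DF :=
  {F | ∀ a, (F (TopologicalSpace.denseSeq I a) : ℝ) = (Lagrange.interpolate Finset.univ
    (fun i : Fin (k + 1) => ((bernstein.z i : I) : ℝ)) fun i => (F (bernstein.z i) : ℝ)).eval
      (TopologicalSpace.denseSeq I a : ℝ)}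

theorem measurable_eval_interpolate (k : ℕ) (t : ℝ) : Measurable fun F : DF =>
    (Lagrange.interpolate Finset.univ (fun i : Fin (k + 1) => ((bernstein.z i : I) : ℝ))
      fun i => (F (bernstein.z i) : ℝ)).eval t := by
  simp only [Lagrange.interpolate_apply, Polynomial.eval_finsetSum, Polynomial.eval_mul,
    Polynomial.eval_C]
  exact Finset.measurable_sum _ fun i _ =>
    (measurable_subtype_coe.comp (measurable_apply _)).mul_const _

theorem measurable_eval_derivative_interpolate (k : ℕ) (t : ℝ) : Measurable fun F : DF =>
    (Polynomial.derivative (Lagrange.interpolate Finset.univ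
      (fun i : Fin (k + 1) => ((bernstein.z i : I) : ℝ))
      fun i => (F (bernstein.z i) : ℝ))).eval t := by
  simp only [Lagrange.interpolate_apply, Polynomial.derivative_sum, Polynomial.derivative_C_mul,
    Polynomial.eval_finsetSum, Polynomial.eval_mul, Polynomial.eval_C]
  exact Finset.measurable_sum _ fun i _ =>
    (measurable_subtype_coe.comp (measurable_apply _)).mul_const _

theorem measurableSet_interpolated (k : ℕ) : MeasurableSet (interpolated k) := by
  simp only [interpolated, Set.ofPred_forall]
  exact MeasurableSet.iInter fun a => measurableSet_eq_fun
    (measurable_subtype_coe.comp (measurable_apply _)) (measurable_eval_interpolate k _)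

theorem density_of_mem_interpolated {k : ℕ} {F : DF} (hF : F ∈ interpolated k) (x : I) :
    density F x = (Polynomial.derivative (Lagrange.interpolate Finset.univ
      (fun i : Fin (k + 1) => ((bernstein.z i : I) : ℝ))
      fun i => (F (bernstein.z i) : ℝ))).eval (x : ℝ) := by
  refine density_eq_of_hasDerivAt (fun t => ?_) (Polynomial.hasDerivAt _ _)
  have hc : Continuous fun t : I => (F t : ℝ) := continuous_subtype_val.comp F.continuous
  exact congrFun ((TopologicalSpace.denseRange_denseSeq I).equalizer hc
    ((Polynomial.continuous _).comp continuous_subtype_val) (funext hF)) t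

theorem bernsteinDF_mem_interpolated (k : ℕ+) (G : DistFun) :
    bernsteinDF k G ∈ interpolated k := by
  intro a
  have hinj : InjOn (fun i : Fin ((k : ℕ) + 1) => ((bernstein.z i : I) : ℝ))
      (Finset.univ : Finset (Fin ((k : ℕ) + 1))) := by
    intro i _ j _ hij
    have hk : ((k : ℕ) : ℝ) ≠ 0 := Nat.cast_ne_zero.2 k.ne_zero
    simp only [bernstein.z] at hij
    exact Fin.ext (Nat.cast_injective (R := ℝ) ((div_left_inj' hk).1 hij))
  let p : Polynomial ℝ := ∑ i : Fin ((k : ℕ) + 1), Polynomial.C (G.1 (bernstein.z i)) *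
    bernsteinPolynomial ℝ (k : ℕ) i
  have hp : ∀ t : I, (bernsteinDF k G t : ℝ) = p.eval (t : ℝ) := fun t => by
    simp [p, bernsteinDF_apply, bernsteinFun, Polynomial.eval_finsetSum, bernsteinPolynomial]
  have hdeg : p.degree < (Finset.univ : Finset (Fin ((k : ℕ) + 1))).card := by
    have hn : p.natDegree ≤ (k : ℕ) := by
      refine Polynomial.natDegree_sum_le_of_forall_le _ _ fun i _ => ?_
      have hi : (i : ℕ) + ((k : ℕ) - i) = k := by omega
      rw [bernsteinPolynomial]
      have h1 : (1 - Polynomial.X : Polynomial ℝ).natDegree ≤ 1 := by compute_degree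
      refine (Polynomial.natDegree_C_mul_le _ _).trans (Polynomial.natDegree_mul_le.trans ?_)
      refine (add_le_add Polynomial.natDegree_mul_le Polynomial.natDegree_pow_le).trans ?_
      rw [Polynomial.natDegree_natCast, zero_add, Polynomial.natDegree_X_pow]
      exact (Nat.add_le_add_left (Nat.mul_le_mul_left _ h1) _).trans (by omega)
    rw [Finset.card_univ, Fintype.card_fin]
    exact Polynomial.degree_le_natDegree.trans_lt (by exact_mod_cast Nat.lt_succ_of_le hn)
  have := Lagrange.eq_interpolate hinj hdeg
  rw [hp, this]
  simp only [hp]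

/-- A derivative is not obviously a measurable function of the evaluations on all of `DF`. The
prior, however, is carried by polynomials of countably many degrees, and on each piece `interpolated
m` the density is the derivative of a Lagrange interpolant, a finite linear combination of
evaluations. -/
theorem aemeasurable_density {Ω₀ : Type*} [MeasurableSpace Ω₀] (ρ : Measure Ω₀) {k : Ω₀ → ℕ+}
    {G : Ω₀ → DistFun} (h : Measurable fun ω => bernsteinDF (k ω) (G ω)) (x : I) :
    AEMeasurable (fun F => density F x) (bernsteinPrior ρ k G) := by
  have hU : MeasurableSet (⋃ k, interpolated k) := MeasurableSet.iUnion measurableSet_interpolated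
  have hae : ∀ᵐ F ∂bernsteinPrior ρ k G, F ∈ ⋃ k, interpolated k := by
    rw [bernsteinPrior, ae_map_iff h.aemeasurable (p := (· ∈ ⋃ k, interpolated k)) hU]
    exact ae_of_all _ fun ω => mem_iUnion.2 ⟨k ω, bernsteinDF_mem_interpolated _ _⟩
  rw [← Measure.restrict_eq_self_of_ae_mem hae, aemeasurable_iUnion_iff]
  intro m
  exact (measurable_eval_derivative_interpolate m x).aemeasurable.congr
    ((ae_restrict_iff' (measurableSet_interpolated m)).2
      (ae_of_all _ fun F hF => (density_of_mem_interpolated hF x).symm))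

/-! ### Measurability in the prior parameters -/

theorem measurable_distFun_apply {Ω₀ : Type*} [MeasurableSpace Ω₀] {G : Ω₀ → DistFun}
    (hG : Measurable G) (t : I) : Measurable fun ω => (G ω).1 t :=
  (measurable_pi_apply t).comp (measurable_subtype_coe.comp hG)

theorem measurable_weights {Ω₀ : Type*} [MeasurableSpace Ω₀] {G : Ω₀ → DistFun}
    (hG : Measurable G) (κ : ℕ+) (j : Fin κ) : Measurable fun ω => weights κ (G ω) j :=
  (measurable_distFun_apply hG _).sub (measurable_distFun_apply hG _)

/-- A function depending measurably on `ω` for each fixed value of a countably valued `k`. -/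
theorem measurable_of_forall_pnat {α β : Type*} [MeasurableSpace α] [MeasurableSpace β]
    {k : α → ℕ+} (hk : ∀ κ, MeasurableSet (k ⁻¹' {κ})) {g : ℕ+ → α → β}
    (hg : ∀ κ, Measurable (g κ)) : Measurable fun a => g (k a) a := by
  intro s hs
  have : (fun a => g (k a) a) ⁻¹' s = ⋃ κ, k ⁻¹' {κ} ∩ g κ ⁻¹' s := by
    ext a; simp
  rw [this]
  exact MeasurableSet.iUnion fun κ => (hk κ).inter (hg κ hs)

theorem measurable_bernsteinDF {Ω₀ : Type*} [MeasurableSpace Ω₀] {k : Ω₀ → ℕ+}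
    (hk : ∀ κ, MeasurableSet (k ⁻¹' {κ})) {G : Ω₀ → DistFun} (hG : Measurable G) :
    Measurable fun ω => bernsteinDF (k ω) (G ω) := by
  refine measurable_of_forall_pnat (g := fun κ ω => bernsteinDF κ (G ω)) hk fun κ =>
    measurable_of_apply fun t => Measurable.subtype_mk ?_
  exact Finset.measurable_sum _ fun i _ => (measurable_distFun_apply hG _).mul_const _

theorem measurable_bernsteinDensity {Ω₀ : Type*} [MeasurableSpace Ω₀] {k : Ω₀ → ℕ+}
    (hk : ∀ κ, MeasurableSet (k ⁻¹' {κ})) {G : Ω₀ → DistFun} (hG : Measurable G) :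
    Measurable fun p : Ω₀ × I => bernsteinDensity (k p.1) (G p.1) p.2 := by
  refine measurable_of_forall_pnat (k := fun p : Ω₀ × I => k p.1)
    (g := fun κ p => bernsteinDensity κ (G p.1) p.2) (fun κ => measurable_fst (hk κ)) fun κ => ?_
  refine Finset.measurable_sum _ fun j _ => ((measurable_weights hG κ j).comp measurable_fst).mul ?_
  have : Measurable fun p : Ω₀ × I => (p.2 : ℝ) := measurable_subtype_coe.comp measurable_snd
  fun_prop

/-! ### Prior mass near the true density -/

/-- Since `w` has positive coordinates, the simplex can be replaced by the open orthant: the chart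
`e` enforces the sum condition by itself, so the preimage is a nonempty open set of positive volume.
-/
theorem simplexVolume_pos {k : ℕ} (hk : k ≠ 0) {W : Set (Fin k → ℝ)} (hW : IsOpen W)
    {w : Fin k → ℝ} (hw : w ∈ W) (hpos : ∀ j, 0 < w j) (hsum : ∑ j, w j = 1) :
    0 < simplexVolume k (W ∩ stdSimplex ℝ (Fin k)) := by
  obtain ⟨k, rfl⟩ := Nat.exists_eq_succ_of_ne_zero hk
  let e : (Fin k → ℝ) → Fin (k + 1) → ℝ := fun v => Fin.snoc v (1 - ∑ i, v i)
  have he : Continuous e := by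
    refine continuous_pi fun j => ?_
    refine Fin.lastCases ?_ (fun i => ?_) j
    · simp only [e, Fin.snoc_last]; fun_prop
    · simp only [e, Fin.snoc_castSucc]; fun_prop
  have hwe : e (Fin.init w) = w := by
    have : 1 - ∑ i, Fin.init w i = w (Fin.last k) := by
      rw [← hsum, Fin.sum_univ_castSucc]; simp [Fin.init]
    simp only [e, this, Fin.snoc_init_self]
  have hS : MeasurableSet (W ∩ stdSimplex ℝ (Fin (k + 1))) :=
    hW.measurableSet.inter (isClosed_stdSimplex (𝕜 := ℝ) _).measurableSet
  have hO : IsOpen (e ⁻¹' (W ∩ {w | ∀ j, 0 < w j})) := by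
    refine (hW.inter ?_).preimage he
    simp only [Set.ofPred_forall]
    exact isOpen_iInter_of_finite fun j => isOpen_lt continuous_const (continuous_apply j)
  refine (hO.measure_pos volume ⟨Fin.init w, by rw [mem_preimage, hwe]; exact ⟨hw, hpos⟩⟩).trans_le ?_
  rw [simplexVolume, Measure.restrict_apply hS, inter_assoc, inter_self,
    Measure.map_apply he.measurable hS]
  refine measure_mono fun v hv => ⟨hv.1, fun j => (hv.2 j).le, ?_⟩
  change ∑ j, (Fin.snoc v (1 - ∑ i, v i) : Fin (k + 1) → ℝ) j = 1
  simp [Fin.sum_univ_castSucc]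

theorem HasPositiveWeightDensities.measure_pos {Ω₀ : Type*} [MeasurableSpace Ω₀] {ρ : Measure Ω₀}
    {k : Ω₀ → ℕ+} (hk : ∀ κ, MeasurableSet (k ⁻¹' {κ})) {G : Ω₀ → DistFun} (hG : Measurable G)
    (h : HasPositiveWeightDensities ρ k G) {κ : ℕ+} {W : Set (Fin κ → ℝ)} (hW : IsOpen W)
    {w : Fin κ → ℝ} (hw : w ∈ W) (hpos : ∀ j, 0 < w j) (hsum : ∑ j, w j = 1) :
    0 < ρ (k ⁻¹' {κ} ∩ {ω | weights κ (G ω) ∈ W}) := by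
  obtain ⟨-, l, hl, hlpos, hmap⟩ := h κ
  have hS : MeasurableSet (W ∩ stdSimplex ℝ (Fin κ)) :=
    hW.measurableSet.inter (isClosed_stdSimplex (𝕜 := ℝ) _).measurableSet
  have hm : Measurable fun ω => weights κ (G ω) :=
    measurable_pi_iff.2 fun j => measurable_weights hG _ j
  have h1 : 0 < ((simplexVolume κ).withDensity fun w => ENNReal.ofReal (l w))
      (W ∩ stdSimplex ℝ (Fin κ)) := by
    rw [withDensity_apply _ hS, setLIntegral_pos_iff hl.ennreal_ofReal]
    refine (simplexVolume_pos κ.ne_zero hW hw hpos hsum).trans_le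
      (measure_mono fun v hv => ⟨?_, hv⟩)
    exact (ENNReal.ofReal_pos.2 (hlpos v hv.2)).ne'
  rw [← hmap, Measure.map_apply hm hS, cond_apply (hk _)] at h1
  refine (pos_of_ne_zero (right_ne_zero_of_mul h1.ne')).trans_le (measure_mono ?_)
  exact fun ω hω => ⟨hω.1, hω.2.1⟩

/-- A continuous distribution function, as an element of `DistFun`. -/
def toDistFun (F : DF) : DistFun :=
  ⟨fun t => F t, fun _ _ h => F.monotone h,
    fun _ => (continuous_subtype_val.comp F.continuous).continuousWithinAt,
    congrArg Subtype.val F.map_bot, congrArg Subtype.val F.map_top⟩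

/-- Differentiation lowers the degree by one: the density is a combination of the degree `n` basis
with coefficients `κ * w j`, the form to compare with `bernsteinApproximation n`. -/
theorem bernsteinDensity_eq_sum_bernstein {n : ℕ} {κ : ℕ+} (hκ : (κ : ℕ) = n + 1) (G : DistFun)
    (x : I) : bernsteinDensity κ G x =
      ∑ j : Fin (n + 1), ((n + 1 : ℝ) * weights κ G (j.cast hκ.symm)) * bernstein n j x := by
  rw [bernsteinDensity, ← Equiv.sum_comp (finCongr hκ.symm)]
  refine Finset.sum_congr rfl fun j _ => ?_
  simp only [bernstein_apply, finCongr_apply, Fin.val_cast, hκ, Nat.add_sub_cancel]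
  push_cast
  ring

/-- The quantity `κ * w j` is the average of `f` over the `j`-th cell of length `1 / κ`. -/
theorem le_mul_weights {F : DF} {f : ℝ → ℝ} (hf : ContinuousOn f (Icc 0 1))
    (hF : ∀ t : I, (F t : ℝ) = ∫ s in (0 : ℝ)..t, f s) {κ : ℕ+} {C : ℝ} {j : Fin κ}
    (hC : ∀ t ∈ Icc ((j : ℝ) / (κ : ℕ)) ((j + 1) / (κ : ℕ)), C ≤ f t) :
    C ≤ (κ : ℕ) * weights κ (toDistFun F) j := by
  have hκ : (0 : ℝ) < (κ : ℕ) := Nat.cast_pos.2 κ.pos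
  set a : I := bernstein.z j.castSucc
  set b : I := bernstein.z j.succ
  have ha : (a : ℝ) = (j : ℝ) / (κ : ℕ) := by simp [a, bernstein.z]
  have hb : (b : ℝ) = (j + 1) / (κ : ℕ) := by simp [b, bernstein.z]
  have hab : (a : ℝ) ≤ b := by rw [ha, hb]; gcongr; linarith
  have hi : ∀ s t : I, IntervalIntegrable f volume s t := fun s t =>
    (hf.mono (uIcc_subset_Icc s.2 t.2)).intervalIntegrable
  have hw : weights κ (toDistFun F) j = ∫ s in (a : ℝ)..b, f s := by
    have h : weights κ (toDistFun F) j = (F b : ℝ) - F a := rfl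
    rw [h, hF, hF]
    exact intervalIntegral.integral_interval_sub_left (hi 0 b) (hi 0 a)
  have h1 : ∫ _ in (a : ℝ)..b, C ≤ ∫ s in (a : ℝ)..b, f s :=
    intervalIntegral.integral_mono_on hab intervalIntegrable_const (hi a b) fun t ht =>
      hC t (by rwa [ha, hb] at ht)
  rw [intervalIntegral.integral_const, smul_eq_mul, ha, hb, ← hb, ← ha, ← hw] at h1
  have h2 : (b : ℝ) - a = 1 / (κ : ℕ) := by rw [ha, hb]; ring
  rw [h2, one_div, inv_mul_le_iff₀ hκ] at h1
  exact h1

/-- Around the weights of `F` there is an open set of weights for which the Bernstein density is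
uniformly almost as large as the density of `F`. -/
theorem exists_isOpen_weights {F : DF} {f : ℝ → ℝ} (hf : ContinuousOn f (Icc 0 1)) {c : ℝ}
    (hc : 0 < c) (hcf : ∀ t ∈ Icc (0 : ℝ) 1, c ≤ f t)
    (hF : ∀ t : I, (F t : ℝ) = ∫ s in (0 : ℝ)..t, f s) {δ : ℝ} (hδ : 0 < δ) :
    ∃ (κ : ℕ+) (W : Set (Fin κ → ℝ)), IsOpen W ∧ weights κ (toDistFun F) ∈ W ∧
      (∀ j, 0 < weights κ (toDistFun F) j) ∧
      ∀ G, weights κ G ∈ W → ∀ x : I, f x - δ ≤ bernsteinDensity κ G x := by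
  -- The error `δ` is split in three: oscillation of `f` on a cell, Bernstein approximation of `f`,
  -- and slack that makes the set of weights open.
  obtain ⟨η, hη, hηf⟩ := Metric.uniformContinuousOn_iff.1
    (isCompact_Icc.uniformContinuousOn_of_continuous hf) (δ / 3) (by positivity)
  let g : C(I, ℝ) := ⟨fun t => f t, continuousOn_iff_continuous_domRestrict.1 hf⟩
  obtain ⟨n, ⟨hn, hn'⟩, hn1⟩ := ((Metric.tendsto_nhds.1 (bernsteinApproximation_uniform g) (δ / 3)
    (by positivity)).and ((tendsto_one_div_add_atTop_nhds_zero_nat (𝕜 := ℝ)).eventually_lt_const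
      hη)).and (eventually_ge_atTop 1) |>.exists
  obtain ⟨κ, hκ⟩ : ∃ κ : ℕ+, (κ : ℕ) = n + 1 := ⟨n.succPNat, rfl⟩
  have hn0 : (0 : ℝ) < n + 1 := by positivity
  have hnpos : (0 : ℝ) < n := by exact_mod_cast hn1
  have hκ' : ((κ : ℕ) : ℝ) = n + 1 := by exact_mod_cast hκ
  have hIcc : ∀ j : Fin κ, ∀ t ∈ Icc ((j : ℝ) / (κ : ℕ)) ((j + 1) / (κ : ℕ)),
      t ∈ Icc (0 : ℝ) 1 := by
    intro j t ht
    have hj : (j : ℝ) + 1 ≤ (κ : ℕ) := by exact_mod_cast j.2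
    exact ⟨le_trans (by positivity) ht.1, ht.2.trans (div_le_one_of_le₀ hj (by positivity))⟩
  refine ⟨κ, {w | ∀ j : Fin κ, f (bernstein.z (j.cast hκ) : I) - 2 * δ / 3 < (κ : ℕ) * w j},
    ?_, fun j => ?_, fun j => ?_, fun G hG x => ?_⟩
  · simp only [Set.ofPred_forall]
    exact isOpen_iInter_of_finite fun j =>
      isOpen_lt continuous_const (continuous_const.mul (continuous_apply j))
  · refine (show _ < f (bernstein.z (j.cast hκ) : I) - δ / 3 by linarith).trans_le
      (le_mul_weights hf hF fun t ht => ?_)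
    have hz : ((bernstein.z (j.cast hκ) : I) : ℝ) = (j : ℝ) / n := by simp [bernstein.z]
    have hj : (j : ℝ) ≤ n := by exact_mod_cast (by omega : (j : ℕ) ≤ n)
    have hlo : (j : ℝ) / (κ : ℕ) ≤ j / n := by
      rw [hκ']; gcongr; linarith
    -- The approximation of degree `n` samples at `j / n`, while the weights use `n + 1` cells; the
    -- node `j / n` still lies in the `j`-th cell.
    have hhi : (j : ℝ) / n ≤ (j + 1) / (κ : ℕ) := by
      rw [hκ', div_le_div_iff₀ hnpos hn0]; nlinarith
    have hlen : ((j : ℝ) + 1) / (κ : ℕ) - j / (κ : ℕ) < η := by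
      rw [← sub_div, add_sub_cancel_left, hκ']; exact hn'
    have := hηf t (hIcc j t ht) _ (bernstein.z (j.cast hκ) : I).2 (by
      rw [hz, Real.dist_eq, abs_lt]; constructor <;> linarith [ht.1, ht.2])
    rw [Real.dist_eq, abs_lt] at this
    linarith [this.1]
  · exact pos_of_mul_pos_right (hc.trans_le (le_mul_weights hf hF fun t ht =>
      hcf t (hIcc j t ht))) (Nat.cast_nonneg _)
  · have h1 : f x - δ / 3 ≤ bernsteinApproximation n g x := by
      have := (ContinuousMap.dist_apply_le_dist x).trans_lt hn
      rw [Real.dist_eq, abs_lt] at this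
      have hgx : g x = f x := rfl
      linarith [this.1]
    -- The Bernstein basis is a partition of unity, so subtracting a constant subtracts it from
    -- every coefficient.
    have h2 : bernsteinApproximation n g x - 2 * δ / 3 =
        ∑ j : Fin (n + 1), (f (bernstein.z j : I) - 2 * δ / 3) * bernstein n j x := by
      simp only [sub_mul, Finset.sum_sub_distrib, ← Finset.mul_sum, bernstein.probability, mul_one,
        bernsteinApproximation.apply, smul_eq_mul]
      congr 1
      exact Finset.sum_congr rfl fun j _ => mul_comm _ _
    rw [bernsteinDensity_eq_sum_bernstein hκ]
    refine (show f x - δ ≤ bernsteinApproximation n g x - 2 * δ / 3 by linarith).trans ?_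
    rw [h2]
    refine Finset.sum_le_sum fun j _ => mul_le_mul_of_nonneg_right ?_ bernstein_nonneg
    rw [← hκ']
    exact (hG (j.cast hκ.symm)).le

theorem exists_measure_pos_density_ge {Ω₀ : Type*} [MeasurableSpace Ω₀] {ρ : Measure Ω₀}
    {k : Ω₀ → ℕ+} (hk : ∀ κ, MeasurableSet (k ⁻¹' {κ})) {G : Ω₀ → DistFun} (hG : Measurable G)
    (h : HasPositiveWeightDensities ρ k G) {F : DF} {f : ℝ → ℝ} (hf : ContinuousOn f (Icc 0 1))
    {c : ℝ} (hc : 0 < c) (hcf : ∀ t ∈ Icc (0 : ℝ) 1, c ≤ f t)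
    (hF : ∀ t : I, (F t : ℝ) = ∫ s in (0 : ℝ)..t, f s) {ε : ℝ} (hε : 0 < ε) :
    ∃ N : Set Ω₀, MeasurableSet N ∧ 0 < ρ N ∧
      ∀ ω ∈ N, ∀ x : I, Real.exp (-ε) * f x ≤ bernsteinDensity (k ω) (G ω) x := by
  have hε1 : 0 < 1 - Real.exp (-ε) := sub_pos.2 (Real.exp_lt_one_iff.2 (neg_lt_zero.2 hε))
  -- With additive error `c * (1 - exp (-ε))`, the bound `c ≤ f` turns it into the multiplicative
  -- factor `exp (-ε)`.
  obtain ⟨κ, W, hW, hmem, hpos, hbound⟩ := exists_isOpen_weights hf hc hcf hF (mul_pos hc hε1)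
  refine ⟨_, (hk κ).inter ((measurable_pi_iff.2 fun j => measurable_weights hG κ j)
    hW.measurableSet), h.measure_pos hk hG hW hmem hpos (sum_weights _ _), fun ω hω x => ?_⟩
  rw [show k ω = κ from hω.1]
  refine le_trans ?_ (hbound _ hω.2 x)
  nlinarith [hcf x x.2]

/-! ### Exponential decay of tilted likelihood ratios -/

section LikelihoodRatio

variable {Ω₀ Ω X : Type*} [MeasurableSpace Ω₀] [MeasurableSpace Ω] [MeasurableSpace X]
  {ρ : Measure Ω₀} {P : Measure Ω} {ν : Measure X} {d : Ω₀ → X → ℝ≥0∞} {g : X → ℝ≥0∞}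
  {x : ℕ → Ω → X} {S : Set Ω₀}

/-- By Tonelli and independence the expectation is an integral over `S` of products of one-point
expectations; under the true density `g` the ratio `d ω / g` changes the measure, leaving `∫ v * d
ω`. -/
theorem lintegral_likelihoodRatio_le [IsProbabilityMeasure ρ] [IsProbabilityMeasure P]
    (hd : Measurable (Function.uncurry d)) (hg : Measurable g) (hg0 : ∀ y, g y ≠ 0)
    (hgt : ∀ y, g y ≠ ∞) (hx : ∀ j, Measurable (x j)) (hindep : iIndepFun x P)
    (hlaw : ∀ j, P.map (x j) = ν.withDensity g) (hS : MeasurableSet S) {v : X → ℝ≥0∞}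
    (hv : Measurable v) {c : ℝ≥0∞} (hc : ∀ ω ∈ S, ∫⁻ y, v y * d ω y ∂ν ≤ c) (m : ℕ) :
    ∫⁻ w, ∫⁻ ω in S, ∏ j ∈ Finset.range m, (d ω (x j w) / g (x j w) * v (x j w)) ∂ρ ∂P
      ≤ c ^ m := by
  have hdω : ∀ ω, Measurable (d ω) := fun ω => hd.of_uncurry_left
  have hmeas : Measurable fun p : Ω × Ω₀ =>
      ∏ j ∈ Finset.range m, (d p.2 (x j p.1) / g (x j p.1) * v (x j p.1)) := by
    refine Finset.measurable_prod _ fun j _ => ?_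
    have hxj : Measurable fun p : Ω × Ω₀ => x j p.1 := (hx j).comp measurable_fst
    exact ((hd.comp (measurable_snd.prodMk hxj)).div (hg.comp hxj)).mul (hv.comp hxj)
  rw [lintegral_lintegral_swap hmeas.aemeasurable]
  have hω : ∀ ω ∈ S, ∫⁻ w, ∏ j ∈ Finset.range m, (d ω (x j w) / g (x j w) * v (x j w)) ∂P
      ≤ c ^ m := by
    intro ω hωS
    have hφ : Measurable fun y => d ω y / g y * v y := ((hdω ω).div hg).mul hv
    have h1 := lintegral_prod_eq_prod_lintegral_of_indepFun (Finset.range m)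
      (fun j w => d ω (x j w) / g (x j w) * v (x j w))
      (hindep.comp (fun _ y => d ω y / g y * v y) fun _ => hφ) fun j => hφ.comp (hx j)
    rw [h1]
    refine (Finset.prod_le_pow_card _ _ c fun j _ => ?_).trans (by simp)
    rw [← lintegral_map hφ (hx j), hlaw j, lintegral_withDensity_eq_lintegral_mul _ hg hφ]
    refine le_of_eq_of_le (lintegral_congr fun y => ?_) (hc ω hωS)
    rw [Pi.mul_apply, ← mul_assoc, ENNReal.mul_div_cancel (hg0 y) (hgt y), mul_comm]
  refine (setLIntegral_mono_ae' hS (ae_of_all _ hω)).trans ?_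
  rw [setLIntegral_const]
  exact mul_le_of_le_one_right' prob_le_one

/-- The expected sum over `m` is dominated by a geometric series of ratio `exp (b - a)`, so almost
surely the terms tend to zero. -/
theorem ae_eventually_exp_mul_likelihoodRatio_le [IsProbabilityMeasure ρ] [IsProbabilityMeasure P]
    (hd : Measurable (Function.uncurry d)) (hg : Measurable g) (hg0 : ∀ y, g y ≠ 0)
    (hgt : ∀ y, g y ≠ ∞) (hx : ∀ j, Measurable (x j)) (hindep : iIndepFun x P)
    (hlaw : ∀ j, P.map (x j) = ν.withDensity g) (hS : MeasurableSet S) {v : X → ℝ≥0∞}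
    (hv : Measurable v) {a b : ℝ} (hba : b < a)
    (hc : ∀ ω ∈ S, ∫⁻ y, v y * d ω y ∂ν ≤ ENNReal.ofReal (Real.exp (-a))) :
    ∀ᵐ w ∂P, ∀ᶠ m : ℕ in atTop, ENNReal.ofReal (Real.exp (b * m)) *
      ∫⁻ ω in S, ∏ j ∈ Finset.range m, (d ω (x j w) / g (x j w) * v (x j w)) ∂ρ ≤ 1 := by
  have hmeas : ∀ m : ℕ, Measurable fun w =>
      ∫⁻ ω in S, ∏ j ∈ Finset.range m, (d ω (x j w) / g (x j w) * v (x j w)) ∂ρ := by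
    intro m
    refine Measurable.lintegral_prod_right' (f := fun p : Ω × Ω₀ =>
      ∏ j ∈ Finset.range m, (d p.2 (x j p.1) / g (x j p.1) * v (x j p.1))) ?_
    refine Finset.measurable_prod _ fun j _ => ?_
    have hxj : Measurable fun p : Ω × Ω₀ => x j p.1 := (hx j).comp measurable_fst
    exact ((hd.comp (measurable_snd.prodMk hxj)).div (hg.comp hxj)).mul (hv.comp hxj)
  have hr : ENNReal.ofReal (Real.exp (b - a)) < 1 := by
    rw [ENNReal.ofReal_lt_one]
    exact Real.exp_lt_one_iff.2 (sub_neg.2 hba)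
  have hsum : ∫⁻ w, ∑' m : ℕ, ENNReal.ofReal (Real.exp (b * m)) *
      ∫⁻ ω in S, ∏ j ∈ Finset.range m, (d ω (x j w) / g (x j w) * v (x j w)) ∂ρ ∂P ≠ ∞ := by
    rw [lintegral_tsum fun m => ((hmeas m).const_mul _).aemeasurable]
    refine ne_top_of_le_ne_top ?_ (ENNReal.tsum_le_tsum fun m =>
      (?_ : _ ≤ ENNReal.ofReal (Real.exp (b - a)) ^ m))
    · rw [ENNReal.tsum_geometric]
      exact ENNReal.inv_ne_top.2 (tsub_pos_of_lt hr).ne'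
    · rw [lintegral_const_mul _ (hmeas m)]
      refine (mul_le_mul_right (lintegral_likelihoodRatio_le hd hg hg0 hgt hx hindep hlaw hS hv
        hc m) _).trans ?_
      rw [mul_comm b, Real.exp_nat_mul, ENNReal.ofReal_pow (Real.exp_pos _).le, ← mul_pow,
        ← ENNReal.ofReal_mul (Real.exp_pos _).le, ← Real.exp_add, sub_eq_add_neg]
  filter_upwards [ae_lt_top (Measurable.tsum fun m => (hmeas m).const_mul _) hsum] with w hw
  exact (ENNReal.tendsto_atTop_zero_of_tsum_ne_top hw.ne).eventually_le_const zero_lt_one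

theorem exists_ae_eventually_likelihoodRatio_le [IsProbabilityMeasure ρ] [IsProbabilityMeasure P]
    (hd : Measurable (Function.uncurry d)) (hg : Measurable g) (hg0 : ∀ y, g y ≠ 0)
    (hgt : ∀ y, g y ≠ ∞) (hx : ∀ j, Measurable (x j)) (hindep : iIndepFun x P)
    (hlaw : ∀ j, P.map (x j) = ν.withDensity g) (hS : MeasurableSet S) {ψ : X → ℝ}
    (hψ : Measurable ψ) {K : ℝ} (hK : ∀ y, |ψ y| ≤ K) {a : ℝ}
    (hc : ∀ ω ∈ S, ∫⁻ y, ENNReal.ofReal (Real.exp (ψ y)) * d ω y ∂ν ≤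
      ENNReal.ofReal (Real.exp (-a))) (ha : -a < ∫ y, ψ y ∂ν.withDensity g) :
    ∃ δ > 0, ∀ᵐ w ∂P, ∀ᶠ m : ℕ in atTop,
      ∫⁻ ω in S, ∏ j ∈ Finset.range m, (d ω (x j w) / g (x j w)) ∂ρ
        ≤ ENNReal.ofReal (Real.exp (-(δ * m))) := by
  set e := ∫ y, ψ y ∂ν.withDensity g with he
  have hslln := strong_law_ae_real (μ := P) (fun j w => ψ (x j w))
    (Integrable.of_bound (hψ.comp (hx 0)).aestronglyMeasurable K (ae_of_all _ fun w => hK _))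
    (fun i j hij => (hindep.indepFun hij).comp hψ hψ)
    (fun j => ⟨(hψ.comp (hx j)).aemeasurable, (hψ.comp (hx 0)).aemeasurable, by
      rw [show (fun w => ψ (x j w)) = ψ ∘ x j from rfl, show (fun w => ψ (x 0 w)) = ψ ∘ x 0 from rfl,
        ← Measure.map_map hψ (hx j), ← Measure.map_map hψ (hx 0), hlaw, hlaw]⟩)
  have he' : ∫ w, ψ (x 0 w) ∂P = e := by
    rw [he, ← hlaw 0, integral_map (hx 0).aemeasurable hψ.aestronglyMeasurable]
  -- One third is lost in taking the rate `b = a - δ`, one third in the strong law, and the last is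
  -- the remaining exponent.
  set δ := (e + a) / 3 with hδ
  have hδ0 : 0 < δ := by simp only [hδ]; linarith
  refine ⟨δ, hδ0, ?_⟩
  filter_upwards [hslln, ae_eventually_exp_mul_likelihoodRatio_le (ρ := ρ) (S := S) (a := a) (b := a - δ) hd hg hg0 hgt
    hx hindep hlaw hS hψ.exp.ennreal_ofReal (by linarith) hc] with w hw1 hw2
  rw [he'] at hw1
  filter_upwards [hw1.eventually_const_lt (show e - δ < e by linarith), hw2,
    eventually_gt_atTop 0] with m hm1 hm2 hm0
  have hm0' : (0 : ℝ) < m := Nat.cast_pos.2 hm0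
  rw [lt_div_iff₀ hm0'] at hm1
  have hprod : ∀ ω, ∏ j ∈ Finset.range m,
      (d ω (x j w) / g (x j w) * ENNReal.ofReal (Real.exp (ψ (x j w)))) =
      ENNReal.ofReal (Real.exp (∑ j ∈ Finset.range m, ψ (x j w))) *
        ∏ j ∈ Finset.range m, (d ω (x j w) / g (x j w)) := by
    intro ω
    rw [Finset.prod_mul_distrib, mul_comm, Real.exp_sum,
      ENNReal.ofReal_prod_of_nonneg fun _ _ => (Real.exp_pos _).le]
  simp only [hprod] at hm2
  rw [lintegral_const_mul' _ _ ENNReal.ofReal_ne_top, ← mul_assoc,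
    ← ENNReal.ofReal_mul (Real.exp_pos _).le, ← Real.exp_add] at hm2
  have hle : δ * m ≤ (a - δ) * m + ∑ j ∈ Finset.range m, ψ (x j w) := by
    have : e + a = 3 * δ := by simp only [hδ]; ring
    nlinarith
  rw [Real.exp_neg, ENNReal.ofReal_inv_of_pos (Real.exp_pos _),
    ENNReal.le_inv_iff_mul_le, mul_comm]
  exact (mul_le_mul_left (ENNReal.ofReal_le_ofReal (Real.exp_le_exp.2 hle)) _).trans hm2

theorem ae_lintegral_likelihoodRatio_lt_top [IsProbabilityMeasure ρ] [IsProbabilityMeasure P]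
    (hd : Measurable (Function.uncurry d)) (hg : Measurable g) (hg0 : ∀ y, g y ≠ 0)
    (hgt : ∀ y, g y ≠ ∞) (hx : ∀ j, Measurable (x j)) (hindep : iIndepFun x P)
    (hlaw : ∀ j, P.map (x j) = ν.withDensity g) (h1 : ∀ ω, ∫⁻ y, d ω y ∂ν ≤ 1) :
    ∀ᵐ w ∂P, ∀ m : ℕ, ∫⁻ ω, ∏ j ∈ Finset.range m, (d ω (x j w) / g (x j w)) ∂ρ < ∞ := by
  refine ae_all_iff.2 fun m => ae_lt_top ?_ ?_
  · refine Measurable.lintegral_prod_right' (f := fun p : Ω × Ω₀ =>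
      ∏ j ∈ Finset.range m, (d p.2 (x j p.1) / g (x j p.1))) ?_
    refine Finset.measurable_prod _ fun j _ => ?_
    have hxj : Measurable fun p : Ω × Ω₀ => x j p.1 := (hx j).comp measurable_fst
    exact (hd.comp (measurable_snd.prodMk hxj)).div (hg.comp hxj)
  · have := lintegral_likelihoodRatio_le hd hg hg0 hgt hx hindep hlaw MeasurableSet.univ
      (v := fun _ => 1) measurable_const (c := 1) (ρ := ρ) (by simpa using h1) m
    simp only [mul_one, one_pow, Measure.restrict_univ] at this
    exact ne_top_of_le_ne_top ENNReal.one_ne_top this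

end LikelihoodRatio

/-! ### One-sample evidence and the exponential tilt -/

/-- The mass of `B` under the unnormalised posterior for one sample. -/
def evidence (π : Measure DF) (x : ℕ → I) (m : ℕ) (B : Set DF) : ℝ≥0∞ :=
  ∫⁻ F in B, ∏ j ∈ Finset.range m, ENNReal.ofReal (density F (x j)) ∂π

/-- The integral equals `1 + (exp r - 1) * F t`, and `1 + y ≤ exp y`. -/
theorem lintegral_exp_indicator_law_le (F : DF) (t : I) (r : ℝ) :
    ∫⁻ y, ENNReal.ofReal (Real.exp ((Iic t).indicator (fun _ => r) y)) ∂(law F : Measure I) ≤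
      ENNReal.ofReal (Real.exp ((Real.exp r - 1) * F t)) := by
  rw [← lintegral_add_compl _ (measurableSet_Iic (a := t)),
    setLIntegral_congr_fun (g := fun _ => ENNReal.ofReal (Real.exp r)) measurableSet_Iic
      fun y hy => by simp only [indicator_of_mem hy],
    setLIntegral_congr_fun (g := fun _ => 1) measurableSet_Iic.compl
      fun y hy => by simp only [indicator_of_notMem hy, Real.exp_zero, ENNReal.ofReal_one],
    setLIntegral_const, setLIntegral_const, prob_compl_eq_one_sub measurableSet_Iic, law_Iic,
    one_mul, ← ENNReal.ofReal_one, ← ENNReal.ofReal_sub _ (F t).2.1,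
    ← ENNReal.ofReal_mul (Real.exp_pos _).le,
    ← ENNReal.ofReal_add (mul_nonneg (Real.exp_pos _).le (F t).2.1) (sub_nonneg.2 (F t).2.2)]
  refine ENNReal.ofReal_le_ofReal ?_
  linarith [Real.add_one_le_exp ((Real.exp r - 1) * F t)]

theorem integral_indicator_law (F : DF) (t : I) (r : ℝ) :
    ∫ y, (Iic t).indicator (fun _ => r) y ∂(law F : Measure I) = F t * r := by
  rw [integral_indicator_const r measurableSet_Iic, Measure.real, law_Iic,
    ENNReal.toReal_ofReal (F t).2.1, smul_eq_mul]

/-- Put `r = (p - q) / 2`. The linear gap `(p - q) * r = 2 * r ^ 2` exceeds the quadratic error of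
`exp r - 1`, which contributes at most `r ^ 2 * q` with `q ≤ 1`. -/
theorem exp_sub_one_mul_lt {p q : ℝ} (hp : p ∈ Icc (0 : ℝ) 1) (hq : q ∈ Icc (0 : ℝ) 1)
    (hpq : p ≠ q) : (Real.exp ((p - q) / 2) - 1) * q < p * ((p - q) / 2) := by
  have h := (abs_le.1 (Real.abs_exp_sub_one_sub_id_le (x := (p - q) / 2)
    (abs_le.2 ⟨by linarith [hp.1, hq.2], by linarith [hp.2, hq.1]⟩))).2
  have hpos : 0 < ((p - q) / 2) ^ 2 := by
    have : (p - q) / 2 ≠ 0 := div_ne_zero (sub_ne_zero.2 hpq) two_ne_zero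
    positivity
  nlinarith [mul_le_mul_of_nonneg_right h hq.1, hq.2]

/-! ### Posterior consistency for one sample -/

section Prior

variable {Ω₀ : Type*} [MeasurableSpace Ω₀] {ρ : Measure Ω₀} {k : Ω₀ → ℕ+} {G : Ω₀ → DistFun}

theorem aemeasurable_prod_density (hk : ∀ κ, MeasurableSet (k ⁻¹' {κ})) (hG : Measurable G)
    (x : ℕ → I) (m : ℕ) :
    AEMeasurable (fun F => ∏ j ∈ Finset.range m, ENNReal.ofReal (density F (x j)))
      (bernsteinPrior ρ k G) :=
  Finset.aemeasurable_fun_prod _ fun j _ =>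
    (aemeasurable_density ρ (measurable_bernsteinDF hk hG) (x j)).ennreal_ofReal

/-- The factor `∏ g (x j)` does not depend on `B`, so it cancels in posterior probabilities. Moving
the integral to `Ω₀` makes the integrand jointly measurable in parameter and data. -/
theorem evidence_bernsteinPrior (hk : ∀ κ, MeasurableSet (k ⁻¹' {κ})) (hG : Measurable G)
    (x : ℕ → I) (m : ℕ) {B : Set DF} (hB : MeasurableSet B) {g : I → ℝ≥0∞} (hg0 : ∀ y, g y ≠ 0)
    (hgt : ∀ y, g y ≠ ∞) :
    evidence (bernsteinPrior ρ k G) x m B = (∏ j ∈ Finset.range m, g (x j)) *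
      ∫⁻ ω in (fun ω => bernsteinDF (k ω) (G ω)) ⁻¹' B, ∏ j ∈ Finset.range m,
        (ENNReal.ofReal (bernsteinDensity (k ω) (G ω) (x j)) / g (x j)) ∂ρ := by
  have hf := measurable_bernsteinDF hk hG
  have hae := (aemeasurable_prod_density (ρ := ρ) hk hG x m).mono_measure
    (Measure.restrict_le_self (s := B))
  rw [← lintegral_const_mul' _ _ (ENNReal.prod_ne_top fun j _ => hgt _), evidence]
  rw [bernsteinPrior, Measure.restrict_map hf hB] at hae ⊢
  rw [lintegral_map' hae hf.aemeasurable]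
  refine lintegral_congr fun ω => ?_
  rw [← Finset.prod_mul_distrib]
  refine Finset.prod_congr rfl fun j _ => ?_
  rw [density_bernsteinDF, ENNReal.mul_div_cancel (hg0 _) (hgt _)]

theorem le_lintegral_likelihoodRatio (hk : ∀ κ, MeasurableSet (k ⁻¹' {κ})) (hG : Measurable G)
    (h : HasPositiveWeightDensities ρ k G) {F : DF} {f : ℝ → ℝ} (hf : ContinuousOn f (Icc 0 1))
    {c : ℝ} (hc : 0 < c) (hcf : ∀ t ∈ Icc (0 : ℝ) 1, c ≤ f t)
    (hF : ∀ t : I, (F t : ℝ) = ∫ s in (0 : ℝ)..t, f s) {ε : ℝ} (hε : 0 < ε) :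
    ∃ b : ℝ≥0∞, b ≠ 0 ∧ ∀ (x : ℕ → I) (m : ℕ), ENNReal.ofReal (Real.exp (-(ε * m))) * b ≤
      ∫⁻ ω, ∏ j ∈ Finset.range m, (ENNReal.ofReal (bernsteinDensity (k ω) (G ω) (x j)) /
        ENNReal.ofReal (f (x j))) ∂ρ := by
  obtain ⟨N, hN, hN0, hNf⟩ := exists_measure_pos_density_ge hk hG h hf hc hcf hF hε
  refine ⟨ρ N, hN0.ne', fun x m => ?_⟩
  rw [← setLIntegral_const]
  refine (setLIntegral_mono_ae' hN (ae_of_all _ fun ω hω => ?_)).trans (setLIntegral_le_lintegral _ _)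
  have h1 : ENNReal.ofReal (Real.exp (-(ε * m))) =
      ∏ _j ∈ Finset.range m, ENNReal.ofReal (Real.exp (-ε)) := by
    rw [Finset.prod_const, Finset.card_range, ← ENNReal.ofReal_pow (Real.exp_pos _).le,
      ← Real.exp_nat_mul]
    congr 2; ring
  rw [h1]
  refine Finset.prod_le_prod' fun j _ => ?_
  have hpos : 0 < f (x j) := hc.trans_le (hcf _ (x j).2)
  rw [← ENNReal.ofReal_div_of_pos hpos]
  exact ENNReal.ofReal_le_ofReal ((le_div_iff₀ hpos).2 (hNf ω hω (x j)))

variable [IsProbabilityMeasure ρ] {F₀ : DF} {Ω : Type*} [MeasurableSpace Ω] {P : Measure Ω}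
  [IsProbabilityMeasure P] {x : ℕ → Ω → I}

theorem ae_evidence_ne_zero_and_ne_top (hk : ∀ κ, MeasurableSet (k ⁻¹' {κ})) (hG : Measurable G)
    (h : HasPositiveWeightDensities ρ k G) (hF₀ : HasContinuousDensityBoundedBelow F₀)
    (hx : ∀ j, Measurable (x j)) (hindep : iIndepFun x P) (hlaw : ∀ j, P.map (x j) = law F₀) :
    ∀ᵐ w ∂P, ∀ m, evidence (bernsteinPrior ρ k G) (fun j => x j w) m univ ≠ 0 ∧
      evidence (bernsteinPrior ρ k G) (fun j => x j w) m univ ≠ ∞ := by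
  obtain ⟨f, hf, ⟨c, hc, hcf⟩, hF⟩ := hF₀
  have hfpos : ∀ y : I, 0 < f y := fun y => hc.trans_le (hcf y y.2)
  have hg0 : ∀ y : I, ENNReal.ofReal (f y) ≠ 0 := fun y => (ENNReal.ofReal_pos.2 (hfpos y)).ne'
  have hg : Measurable fun y : I => ENNReal.ofReal (f y) :=
    (continuousOn_iff_continuous_domRestrict.1 hf).measurable.ennreal_ofReal
  have hfin := ae_lintegral_likelihoodRatio_lt_top (ρ := ρ) (ν := (volume : Measure I))
    (d := fun ω y => ENNReal.ofReal (bernsteinDensity (k ω) (G ω) y))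
    (measurable_bernsteinDensity hk hG).ennreal_ofReal hg hg0 (fun _ => ENNReal.ofReal_ne_top)
    hx hindep (fun j => by
      rw [hlaw, law_eq_withDensity hf (fun t ht => hc.le.trans (hcf t ht)) hF]) (fun ω => by
      rw [← setLIntegral_univ, ← withDensity_apply _ MeasurableSet.univ, ← law_bernsteinDF]
      exact prob_le_one)
  obtain ⟨b, hb, hbl⟩ := le_lintegral_likelihoodRatio hk hG h hf hc hcf hF one_pos
  filter_upwards [hfin] with w hw m
  rw [evidence_bernsteinPrior hk hG _ _ MeasurableSet.univ hg0 fun _ => ENNReal.ofReal_ne_top,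
    preimage_univ, Measure.restrict_univ]
  refine ⟨mul_ne_zero (Finset.prod_ne_zero_iff.2 fun j _ => hg0 _) ?_,
    ENNReal.mul_ne_top (ENNReal.prod_ne_top fun j _ => ENNReal.ofReal_ne_top) (hw m).ne⟩
  refine (lt_of_lt_of_le ?_ (hbl (fun j => x j w) m)).ne'
  exact ENNReal.mul_pos (ENNReal.ofReal_pos.2 (Real.exp_pos _)).ne' hb

/-- If `q` separates `F₀ t` from `F t` for every `F ∈ B`, then the posterior probability of `B` tends
to zero. -/
theorem ae_tendsto_evidence_div (hk : ∀ κ, MeasurableSet (k ⁻¹' {κ})) (hG : Measurable G)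
    (h : HasPositiveWeightDensities ρ k G) (hF₀ : HasContinuousDensityBoundedBelow F₀)
    (hx : ∀ j, Measurable (x j)) (hindep : iIndepFun x P) (hlaw : ∀ j, P.map (x j) = law F₀)
    {t q : I} (hq : F₀ t ≠ q) {B : Set DF} (hB : MeasurableSet B)
    (hBq : ∀ F ∈ B, (F₀ t < q → q ≤ F t) ∧ (q < F₀ t → F t ≤ q)) :
    ∀ᵐ w ∂P, Tendsto (fun m => evidence (bernsteinPrior ρ k G) (fun j => x j w) m B /
      evidence (bernsteinPrior ρ k G) (fun j => x j w) m univ) atTop (𝓝 0) := by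
  obtain ⟨f, hf, ⟨c, hc, hcf⟩, hF⟩ := hF₀
  have hfpos : ∀ y : I, 0 < f y := fun y => hc.trans_le (hcf y y.2)
  have hg0 : ∀ y : I, ENNReal.ofReal (f y) ≠ 0 := fun y => (ENNReal.ofReal_pos.2 (hfpos y)).ne'
  have hg : Measurable fun y : I => ENNReal.ofReal (f y) :=
    (continuousOn_iff_continuous_domRestrict.1 hf).measurable.ennreal_ofReal
  have hlaw₀ := law_eq_withDensity hf (fun t ht => hc.le.trans (hcf t ht)) hF
  -- The sign of `r` is that of `F₀ t - q`, so in both cases membership in `B` gives `(exp r - 1) *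
  -- F t ≤ (exp r - 1) * q`, whence the choice of `a` below.
  set r : ℝ := ((F₀ t : ℝ) - q) / 2 with hr
  have hψ : Measurable ((Iic t).indicator fun _ => r) := measurable_const.indicator measurableSet_Iic
  obtain ⟨δ, hδ, hup⟩ := exists_ae_eventually_likelihoodRatio_le (ρ := ρ) (P := P)
    (ν := (volume : Measure I)) (d := fun ω y => ENNReal.ofReal (bernsteinDensity (k ω) (G ω) y))
    (S := (fun ω => bernsteinDF (k ω) (G ω)) ⁻¹' B) (a := -((Real.exp r - 1) * q))
    (measurable_bernsteinDensity hk hG).ennreal_ofReal hg hg0 (fun _ => ENNReal.ofReal_ne_top)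
    hx hindep (fun j => by rw [hlaw, hlaw₀]) (measurable_bernsteinDF hk hG hB) hψ (K := |r|)
    (fun y => by
      by_cases hy : y ∈ Iic t
      · rw [indicator_of_mem hy]
      · rw [indicator_of_notMem hy, abs_zero]; exact abs_nonneg r)
    (fun ω hω => by
      have h1 := lintegral_exp_indicator_law_le (bernsteinDF (k ω) (G ω)) t r
      rw [law_bernsteinDF, lintegral_withDensity_eq_lintegral_mul _
        (f := fun y : I => ENNReal.ofReal (bernsteinDensity (k ω) (G ω) y))
        ((continuous_bernsteinDensity (k ω) (G ω)).measurable.comp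
          measurable_subtype_coe).ennreal_ofReal
        hψ.exp.ennreal_ofReal] at h1
      simp only [Pi.mul_apply, mul_comm (ENNReal.ofReal (bernsteinDensity _ _ _))] at h1
      refine h1.trans (ENNReal.ofReal_le_ofReal (Real.exp_le_exp.2 ?_))
      rw [neg_neg]
      rcases lt_or_gt_of_ne hq with hlt | hgt
      · have h2 : (q : ℝ) ≤ _ := (hBq _ hω).1 hlt
        refine mul_le_mul_of_nonpos_left h2 (sub_nonpos.2 (Real.exp_le_one_iff.2 ?_))
        have : (F₀ t : ℝ) < q := hlt
        linarith
      · have h2 : _ ≤ (q : ℝ) := (hBq _ hω).2 hgt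
        refine mul_le_mul_of_nonneg_left h2 (sub_nonneg.2 (Real.one_le_exp_iff.2 ?_))
        have : (q : ℝ) < F₀ t := hgt
        linarith)
    (by
      rw [← hlaw₀, integral_indicator_law, neg_neg]
      exact exp_sub_one_mul_lt (F₀ t).2 q.2 (fun h => hq (Subtype.ext h)))
  -- Half the numerator's rate is allowed to the denominator, so the quotient still decays like `exp
  -- (-(δ / 2 * m))`.
  obtain ⟨b, hb, hbl⟩ := le_lintegral_likelihoodRatio hk hG h hf hc hcf hF (half_pos hδ)
  filter_upwards [hup] with w hw
  have hlim : Tendsto (fun m : ℕ => ENNReal.ofReal (Real.exp (-(δ / 2 * m))) * b⁻¹) atTop (𝓝 0) := by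
    rw [show (0 : ℝ≥0∞) = ENNReal.ofReal 0 * b⁻¹ by simp]
    refine ENNReal.Tendsto.mul_const (ENNReal.tendsto_ofReal ?_) (Or.inr (ENNReal.inv_ne_top.2 hb))
    exact Real.tendsto_exp_neg_atTop_nhds_zero.comp
      (tendsto_natCast_atTop_atTop.const_mul_atTop (half_pos hδ))
  refine tendsto_of_tendsto_of_tendsto_of_le_of_le' tendsto_const_nhds hlim
    (Eventually.of_forall fun _ => zero_le) ?_
  filter_upwards [hw] with m hm
  rw [evidence_bernsteinPrior hk hG _ _ hB hg0 fun _ => ENNReal.ofReal_ne_top,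
    evidence_bernsteinPrior hk hG _ _ MeasurableSet.univ hg0 fun _ => ENNReal.ofReal_ne_top,
    preimage_univ, Measure.restrict_univ,
    ENNReal.mul_div_mul_left _ _ (Finset.prod_ne_zero_iff.2 fun j _ => hg0 _)
      (ENNReal.prod_ne_top fun j _ => ENNReal.ofReal_ne_top)]
  refine (ENNReal.div_le_div hm (hbl (fun j => x j w) m)).trans_eq ?_
  rw [div_eq_mul_inv, ENNReal.mul_inv (Or.inl (ENNReal.ofReal_pos.2 (Real.exp_pos _)).ne')
    (Or.inl ENNReal.ofReal_ne_top), ← mul_assoc,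
    ← ENNReal.ofReal_inv_of_pos (Real.exp_pos _), ← ENNReal.ofReal_mul (Real.exp_pos _).le,
    ← Real.exp_neg, ← Real.exp_add]
  congr 3; ring

end Prior

/-! ### Factorisation of the joint posterior -/

theorem lintegral_pi_prod_eq_prod_lintegral {ι : Type*} [Fintype ι] {α : ι → Type*}
    [∀ i, MeasurableSpace (α i)] (μ : ∀ i, Measure (α i)) [∀ i, IsProbabilityMeasure (μ i)]
    {φ : ∀ i, α i → ℝ≥0∞} (hφ : ∀ i, AEMeasurable (φ i) (μ i)) :
    ∫⁻ a, ∏ i, φ i (a i) ∂Measure.pi μ = ∏ i, ∫⁻ b, φ i b ∂μ i := by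
  have hae : (fun a : ∀ i, α i => ∏ i, φ i (a i)) =ᵐ[Measure.pi μ]
      fun a => ∏ i, (hφ i).mk _ (a i) := by
    have : ∀ᵐ a ∂Measure.pi μ, ∀ i, φ i (a i) = (hφ i).mk _ (a i) :=
      ae_all_iff.2 fun i => (Measure.quasiMeasurePreserving_eval μ i).ae (hφ i).ae_eq_mk
    filter_upwards [this] with a ha
    exact Finset.prod_congr rfl fun i _ => ha i
  rw [lintegral_congr_ae hae, lintegral_prod_eq_prod_lintegral_of_indepFun Finset.univ
    (fun i (a : ∀ i, α i) => (hφ i).mk _ (a i))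
    (iIndepFun_pi fun i => (hφ i).measurable_mk.aemeasurable)
    fun i => (hφ i).measurable_mk.comp (measurable_pi_apply i)]
  refine Finset.prod_congr rfl fun i _ => ?_
  rw [lintegral_congr_ae (hφ i).ae_eq_mk]
  exact (measurePreserving_eval μ i).lintegral_comp (hφ i).measurable_mk

section JointPosterior

variable {n : ℕ} {π : Measure DF} [IsProbabilityMeasure π] {m : Fin n → ℕ} {x : Fin n → ℕ → I}

theorem setLIntegral_likelihood (hL : ∀ (y : ℕ → I) (l : ℕ), AEMeasurable
      (fun F => ∏ j ∈ Finset.range l, ENNReal.ofReal (density F (y j))) π)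
    {B : Fin n → Set DF} (hB : ∀ i, MeasurableSet (B i)) :
    ∫⁻ F in univ.pi B, likelihood m x F ∂Measure.pi (fun _ : Fin n => π) =
      ∏ i, evidence π (x i) (m i) (B i) := by
  rw [← lintegral_indicator (MeasurableSet.univ_pi hB)]
  have h := lintegral_pi_prod_eq_prod_lintegral (fun _ : Fin n => π)
    (φ := fun i => (B i).indicator
      fun F => ∏ j ∈ Finset.range (m i), ENNReal.ofReal (density F (x i j)))
    fun i => (hL (x i) (m i)).indicator (hB i)
  simp only [lintegral_indicator (hB _)] at h
  refine Eq.trans (lintegral_congr fun F => ?_) h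
  by_cases hF : F ∈ univ.pi B
  · rw [indicator_of_mem hF, likelihood]
    exact Finset.prod_congr rfl fun i _ => by
      rw [indicator_of_mem (hF i (mem_univ i))]
  · rw [indicator_of_notMem hF]
    obtain ⟨i, hi⟩ : ∃ i, F i ∉ B i := by simpa [mem_univ_pi] using hF
    exact (Finset.prod_eq_zero (Finset.mem_univ i) (indicator_of_notMem hi _)).symm

theorem jointPosterior_univ_pi (hL : ∀ (y : ℕ → I) (l : ℕ), AEMeasurable
      (fun F => ∏ j ∈ Finset.range l, ENNReal.ofReal (density F (y j))) π)
    (h0 : ∀ i, evidence π (x i) (m i) univ ≠ 0)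
    {B : Fin n → Set DF} (hB : ∀ i, MeasurableSet (B i)) :
    jointPosterior (Measure.pi fun _ : Fin n => π) m x (univ.pi B) =
      ∏ i, evidence π (x i) (m i) (B i) / evidence π (x i) (m i) univ := by
  have hZ := setLIntegral_likelihood (m := m) (x := x) hL fun _ => MeasurableSet.univ
  rw [pi_univ, Measure.restrict_univ] at hZ
  rw [jointPosterior, Measure.smul_apply, smul_eq_mul,
    withDensity_apply _ (MeasurableSet.univ_pi hB), setLIntegral_likelihood hL hB, hZ]
  simp only [div_eq_mul_inv, Finset.prod_mul_distrib]
  rw [ENNReal.prod_inv_distrib fun i _ j _ _ => Or.inl (h0 i), mul_comm]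

theorem jointPosterior_univ (hL : ∀ (y : ℕ → I) (l : ℕ), AEMeasurable
      (fun F => ∏ j ∈ Finset.range l, ENNReal.ofReal (density F (y j))) π)
    (h0 : ∀ i, evidence π (x i) (m i) univ ≠ 0) (ht : ∀ i, evidence π (x i) (m i) univ ≠ ∞) :
    jointPosterior (Measure.pi fun _ : Fin n => π) m x univ = 1 := by
  have h := jointPosterior_univ_pi hL h0 fun _ : Fin n => MeasurableSet.univ
  rw [pi_univ] at h
  rw [h]
  exact Finset.prod_eq_one fun i _ => ENNReal.div_self (h0 i) (ht i)

/-- All other factors are quotients of an evidence by itself. The `i`-th marginal therefore depends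
on `m` only through `m i`, which is what makes the joint limit harmless. -/
theorem jointPosterior_preimage_eval (hL : ∀ (y : ℕ → I) (l : ℕ), AEMeasurable
      (fun F => ∏ j ∈ Finset.range l, ENNReal.ofReal (density F (y j))) π)
    (h0 : ∀ i, evidence π (x i) (m i) univ ≠ 0) (ht : ∀ i, evidence π (x i) (m i) univ ≠ ∞)
    (i : Fin n) {B : Set DF} (hB : MeasurableSet B) :
    jointPosterior (Measure.pi fun _ : Fin n => π) m x {F | F i ∈ B} =
      evidence π (x i) (m i) B / evidence π (x i) (m i) univ := by
  have hpi : {F : Fin n → DF | F i ∈ B} = univ.pi (Function.update (fun _ => univ) i B) := by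
    rw [univ_pi_update_univ]; rfl
  have hmeas : ∀ l, MeasurableSet (Function.update (fun _ : Fin n => (univ : Set DF)) i B l) := by
    intro l
    rcases eq_or_ne l i with rfl | hl
    · rwa [Function.update_self]
    · rw [Function.update_of_ne hl]; exact MeasurableSet.univ
  rw [hpi, jointPosterior_univ_pi hL h0 hmeas,
    Finset.prod_eq_single_of_mem i (Finset.mem_univ i), Function.update_self]
  intro l _ hl
  rw [Function.update_of_ne hl, ENNReal.div_self (h0 l) (ht l)]

end JointPosterior

/-! ### Concentration expressed by filters -/

/-- The sets whose complements have asymptotically no mass. -/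
def fullMassFilter {ι α : Type*} [MeasurableSpace α] (l : Filter ι) (μ : ι → Measure α) :
    Filter α where
  sets := {S | Tendsto (fun i => μ i Sᶜ) l (𝓝 0)}
  univ_sets := by simp [tendsto_const_nhds]
  sets_of_superset {S T} hS hST := tendsto_of_tendsto_of_tendsto_of_le_of_le tendsto_const_nhds hS
    (fun _ => zero_le) fun _ => measure_mono (compl_subset_compl.2 hST)
  inter_sets {S T} hS hT := by
    refine tendsto_of_tendsto_of_tendsto_of_le_of_le tendsto_const_nhds
      (by simpa using Tendsto.add hS hT) (fun _ => zero_le) fun i => ?_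
    rw [compl_inter]
    exact measure_union_le _ _

theorem mem_fullMassFilter {ι α : Type*} [MeasurableSpace α] {l : Filter ι} {μ : ι → Measure α}
    {S : Set α} : S ∈ fullMassFilter l μ ↔ Tendsto (fun i => μ i Sᶜ) l (𝓝 0) := Iff.rfl

/-- The set `U` need not be measurable, so only outer measure is available: subadditivity bounds the
mass of `T ⁻¹' U` below by one minus that of its complement. -/
theorem tendsto_map_apply_of_fullMassFilter {ι α β : Type*} [MeasurableSpace α] [MeasurableSpace β]
    {l : Filter ι} {μ : ι → Measure α} (hμ : ∀ i, μ i univ = 1) {T : α → β} (hT : Measurable T)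
    {U : Set β} (hU : T ⁻¹' U ∈ fullMassFilter l μ) : Tendsto (fun i => (μ i).map T U) l (𝓝 1) := by
  have h1 : Tendsto (fun i => 1 - μ i (T ⁻¹' U)ᶜ) l (𝓝 1) := by
    simpa using ENNReal.Tendsto.sub tendsto_const_nhds hU (Or.inl ENNReal.one_ne_top)
  refine tendsto_of_tendsto_of_tendsto_of_le_of_le h1 tendsto_const_nhds (fun i => ?_) fun i => ?_
  · refine tsub_le_iff_right.2 ?_
    rw [← hμ i, ← union_compl_self (T ⁻¹' U)]
    exact (measure_union_le _ _).trans
      (add_le_add_left (Measure.le_map_apply hT.aemeasurable U) _)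
  · refine (measure_mono (subset_univ U)).trans_eq ?_
    rw [Measure.map_apply hT MeasurableSet.univ, preimage_univ, hμ]

/-- The distribution functions `F` for which `q` separates `p` from `F t`, in the weak sense. -/
def separated (p q t : I) : Set DF := {F | (p < q → q ≤ F t) ∧ (q < p → F t ≤ q)}

theorem measurableSet_separated (p q t : I) : MeasurableSet (separated p q t) := by
  have h1 := measurableSet_le (measurable_const (a := q)) (measurable_apply t)
  have h2 := measurableSet_le (measurable_apply t) (measurable_const (a := q))
  exact ((MeasurableSet.const _).imp h1).inter ((MeasurableSet.const _).imp h2)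

/-- If `F t` misses an order neighbourhood of `F₀ t`, a point of the dense sequence lies between `F₀
t` and the violated bound and separates them. Hence countably many separated sets suffice. -/
theorem fullMassFilter_le_pointwiseNhds {n : ℕ} {ι : Type*} {l : Filter ι}
    {μ : ι → Measure (Fin n → DF)} {F₀ : Fin n → DF}
    (h : ∀ i a b, F₀ i (TopologicalSpace.denseSeq I a) ≠ TopologicalSpace.denseSeq I b →
      Tendsto (fun j => μ j {F | F i ∈ separated (F₀ i (TopologicalSpace.denseSeq I a))
        (TopologicalSpace.denseSeq I b) (TopologicalSpace.denseSeq I a)}) l (𝓝 0)) :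
    fullMassFilter l μ ≤ pointwiseNhds F₀ := by
  have h' : ∀ i a b, F₀ i (TopologicalSpace.denseSeq I a) ≠ TopologicalSpace.denseSeq I b →
      {F | F i ∈ separated (F₀ i (TopologicalSpace.denseSeq I a))
        (TopologicalSpace.denseSeq I b) (TopologicalSpace.denseSeq I a)}ᶜ ∈ fullMassFilter l μ :=
    fun i a b hab => by rw [mem_fullMassFilter, compl_compl]; exact h i a b hab
  refine tendsto_iff_comap.1 (tendsto_pi_nhds.2 fun p => tendsto_order.2
    ⟨fun s hs => ?_, fun s hs => ?_⟩)
  · obtain ⟨_, ⟨b, rfl⟩, hsb, hb⟩ := (TopologicalSpace.denseRange_denseSeq I).exists_between hs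
    refine mem_of_superset (h' p.1 p.2 b hb.ne') fun F hF => ?_
    by_contra hc
    exact hF ⟨fun h' => absurd h' hb.not_gt, fun _ => (not_lt.1 hc).trans hsb.le⟩
  · obtain ⟨_, ⟨b, rfl⟩, hb, hsb⟩ := (TopologicalSpace.denseRange_denseSeq I).exists_between hs
    refine mem_of_superset (h' p.1 p.2 b hb.ne) fun F hF => ?_
    by_contra hc
    exact hF ⟨fun _ => hsb.le.trans (not_lt.1 hc), fun h' => absurd h' hb.not_gt⟩

/-! ### Joint consistency and its images under continuous maps -/

theorem ae_fullMassFilter_jointPosterior_le {n : ℕ}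
    {Ω₀ : Type*} [MeasurableSpace Ω₀] (ρ : Measure Ω₀) [IsProbabilityMeasure ρ]
    (k : Ω₀ → ℕ+) (hk : ∀ κ, MeasurableSet (k ⁻¹' {κ}))
    (G : Ω₀ → DistFun) (hG : Measurable G) (hprior : HasPositiveWeightDensities ρ k G)
    (F₀ : Fin n → DF) (hF₀ : ∀ i, HasContinuousDensityBoundedBelow (F₀ i))
    {Ω : Type*} [MeasurableSpace Ω] (P : Measure Ω) [IsProbabilityMeasure P]
    (x : Fin n → ℕ → Ω → I) (hx : ∀ i j, Measurable (x i j))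
    (hindep : iIndepFun (fun p : Fin n × ℕ => x p.1 p.2) P)
    (hlaw : ∀ i j, P.map (x i j) = law (F₀ i)) :
    ∀ᵐ ω ∂P, (∀ m, jointPosterior (Measure.pi fun _ : Fin n => bernsteinPrior ρ k G) m
        (fun i j => x i j ω) univ = 1) ∧
      fullMassFilter atTop (fun m => jointPosterior
        (Measure.pi fun _ : Fin n => bernsteinPrior ρ k G) m fun i j => x i j ω) ≤
        pointwiseNhds F₀ := by
  have : IsProbabilityMeasure (bernsteinPrior ρ k G) :=
    Measure.isProbabilityMeasure_map (measurable_bernsteinDF hk hG).aemeasurable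
  have hind : ∀ i, iIndepFun (x i) P := fun i =>
    hindep.precomp (g := fun j => (i, j)) fun _ _ h => (Prod.mk.inj h).2
  have hL := fun (y : ℕ → I) l => aemeasurable_prod_density (ρ := ρ) hk hG y l
  have hev := ae_all_iff.2 fun i =>
    ae_evidence_ne_zero_and_ne_top hk hG hprior (hF₀ i) (hx i) (hind i) (hlaw i)
  have hpost := ae_all_iff.2 fun i => ae_all_iff.2 fun a => ae_all_iff.2 fun b => ae_all_iff.2
    fun hab : F₀ i (TopologicalSpace.denseSeq I a) ≠ TopologicalSpace.denseSeq I b =>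
      ae_tendsto_evidence_div hk hG hprior (hF₀ i) (hx i) (hind i) (hlaw i) hab
        (measurableSet_separated _ _ _) fun F hF => hF
  filter_upwards [hev, hpost] with ω hω hω'
  refine ⟨fun m => jointPosterior_univ hL (fun i => (hω i (m i)).1) fun i => (hω i (m i)).2,
    fullMassFilter_le_pointwiseNhds fun i a b hab => ?_⟩
  refine ((hω' i a b hab).comp (tendsto_atTop_atTop.2 fun c => ⟨fun _ => c, fun m hm => hm i⟩ :
    Tendsto (fun m : Fin n → ℕ => m i) atTop atTop)).congr fun m => ?_
  exact (jointPosterior_preimage_eval hL (fun i => (hω i (m i)).1) (fun i => (hω i (m i)).2) i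
    (measurableSet_separated _ _ _)).symm

theorem weaklyConsistent_map {n : ℕ} {Ω : Type*} [MeasurableSpace Ω] {P : Measure Ω}
    {post : (Fin n → ℕ) → Ω → Measure (Fin n → DF)} {F₀ : Fin n → DF}
    (h : ∀ᵐ ω ∂P, (∀ m, post m ω univ = 1) ∧
      fullMassFilter atTop (fun m => post m ω) ≤ pointwiseNhds F₀)
    {T : (Fin n → DF) → DF} (hT : Measurable T)
    (hc : Tendsto T (pointwiseNhds F₀) (weakNhds (T F₀))) :
    WeaklyConsistent P (fun m ω => (post m ω).map T) (T F₀) := by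
  filter_upwards [h] with ω hω U hU
  exact tendsto_map_apply_of_fullMassFilter hω.1 hT (hω.2 (hc hU))

end BernsteinWarp

end

theorem corollary3 {n : ℕ} [NeZero n]
    -- the Bernstein prior `π(k, G)`
    {Ω₀ : Type*} [MeasurableSpace Ω₀] (ρ : Measure Ω₀) [IsProbabilityMeasure ρ]
    (k : Ω₀ → ℕ+) (hk : ∀ κ, MeasurableSet (k ⁻¹' {κ}))
    (G : Ω₀ → DistFun) (hG : Measurable G)
    (hprior : HasPositiveWeightDensities ρ k G)
    -- the true distribution functions
    (F₀ : Fin n → DF) (hF₀ : ∀ i, HasContinuousDensityBoundedBelow (F₀ i))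
    -- the observed points: independent, with `x i j ∼ F₀ i`
    {Ω : Type*} [MeasurableSpace Ω] (P : Measure Ω) [IsProbabilityMeasure P]
    (x : Fin n → ℕ → Ω → I) (hx : ∀ i j, Measurable (x i j))
    (hindep : iIndepFun (fun p : Fin n × ℕ => x p.1 p.2) P)
    (hlaw : ∀ i j, P.map (x i j) = law (F₀ i)) :
    WeaklyConsistent P
      (fun m ω => (jointPosterior (Measure.pi fun _ : Fin n => bernsteinPrior ρ k G) m
        (fun i j => x i j ω)).map frechetMean)
      (frechetMean F₀) ∧
    ∀ i, WeaklyConsistent P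
      (fun m ω => (jointPosterior (Measure.pi fun _ : Fin n => bernsteinPrior ρ k G) m
        (fun i j => x i j ω)).map (warp i))
      (warp i F₀) := by
  have h := ae_fullMassFilter_jointPosterior_le ρ k hk G hG hprior F₀ hF₀ P x hx hindep hlaw
  exact ⟨weaklyConsistent_map h measurable_frechetMean (tendsto_frechetMean F₀),
    fun i => weaklyConsistent_map h (measurable_warp i) (tendsto_warp i F₀)⟩
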